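/- **Theorem 2 (Type II moves).** Let $\hbar>0$. *Setting.* A coarse-graining move of type II $k\to k+1$ removes $K$ old variables $x^o\in\mathbb R^K$; the variables $x^e,x^b$ are kept. Its action contribution is a smooth function $S(x^o,x^e)$. The kinematical Hilbert spaces are $L^2$ of the spaces of $x=(x^o,x^e,x^b)$ at $k$ and of $(x^e,x^b)$ at $k+1$. The move has the $K$ pre-constraints $\hat C_o=\hat p_o+\partial S/\partial x^o=e^{-iS/\hbar}\hat p_o\,e^{iS/\hbar}$, where $\hat p=-i\hbar\,\partial$. They are split as $o=(\alpha,\beta)$, $K=K_\alpha+K_\beta$. The $\hat C_\alpha$ are also post-constraints at $k$ (case (i)). The $\hat C_\beta$ are first class and do not annihilate all post-physical states at $k$ (case (ii)). The other post-constraints at $k$ are finitely many operators $\hat C^k_j$, each a convergent ordered power series in $\hat x^e,\hat x^b$ and in the updated momenta $\hat p_o+\partial S/\partial x^o$, $\hat p_e+\partial S/\partial x^e$, $\hat p_b$. The time-evolved constraint $\hat C^{k+1}_j$ is the same series in $\hat x^e,\hat x^b$ and $0,\hat p_e,\hat p_b$ (momentum updating). At both steps the post-constraints commute, are self-adjoint,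 and are defined, together with the unitary groups they generate, on a dense invariant space $\Phi$ of test states: $e^{iS/\hbar}f$ is a Schwartz function for $f\in\Phi_k$, and the elements of $\Phi_{k+1}$ are Schwartz functions. The series and the generators of the groups converge in the Schwartz topology. The space $\Phi_k$ is invariant also under the $\hat C_o$ and their unitary groups, and $\Phi_{k+1}=\{\int dx^o\,e^{iS/\hbar}f : f\in\Phi_k\}$. Post-physical states are the group averages $\psi=\mathbb P f$, $f\in\Phi$, with $\mathbb P=\prod_I\delta(\hat C_I)$ over all post-constraints of the step and $\delta(\hat C)=\frac1{2\pi\hbar}\int ds\,e^{is\hat C/\hbar}$. The inner product is $\langle \mathbb P f|\mathbb P g\rangle_{\rm phys}=\langle f|\mathbb P g\rangle$, and the physical Hilbert spaces ${}^+\mathcal H^{\rm phys}_k$, ${}^+\mathcal H^{\rm phys}_{k+1}$ are the completions. A state $\psi$ is annihilated by $\hat C$ if $\int\overline{\hat C f}\,\psi=0$ for all $f\in\Phi$. Finally $\mathbb P^B=\prod_\beta\delta(\hat C_\beta)$. All these averages, the integral below, and the pairings of test states with $\mathbb P^B\psi$ are assumed to converge absolutely. *Claim.* For every constant $M\in\mathbb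 C$ and every choice of gauge-fixing values $x'^\alpha$, the regularized state updating map $$\mathfrak u\,\psi=(2\pi\hbar)^{K_\alpha}\int\prod_o dx^o\,\prod_\alpha\delta(x'^\alpha-x^\alpha)\,M\,e^{iS(x^e,x^o)/\hbar}\,\psi(x)$$ maps post-physical states at $k$ linearly to post-physical states at $k+1$, and states of norm zero to states of norm zero. It preserves the post-constraints: $\mathfrak u\psi$ is annihilated by every $\hat C^{k+1}_j$, and if any constraint with a power series as above, convergent on $\Phi_k$ and mapping $\Phi_k$ to itself, annihilates a post-physical state $\psi$ at $k$, then its time-evolved version annihilates $\mathfrak u\psi$. For all $f\in\Phi_k$ and all post-physical $\phi$ at $k$, $$\langle \mathfrak u\,\mathbb P f\,|\,\mathfrak u\,\phi\rangle_{\rm phys}=|M|^2(2\pi\hbar)^K\,\langle f|\,\mathbb P^B\phi\rangle .$$ Moreover: 1. If no pre-constraint of case (ii) occurs ($K_\beta=0$) and $|M|=(2\pi\hbar)^{-K/2}$, then $\mathfrak u$ extends to a unitary map ${}^+\mathcal H^{\rm phys}_k\to{}^+\mathcal H^{\rm phys}_{k+1}$. 2. If at least one pre-constraint of case (ii) occurs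 ($K_\beta\ge1$), then for every constant $M$ the map $\mathfrak u$ does not preserve the physical inner product and does not extend to a unitary map. -/

import Mathlib

open MeasureTheory Filter Topology
open scoped ContDiff ComplexConjugate SchwartzMap

set_option linter.unusedSectionVars false

noncomputable section

namespace QMove

/-! ### Position representation: phases, momenta, test functions -/

/-- The phase `e^{i S / ħ}` of a real function `S` on a configuration space. -/
def phase (hbar : ℝ) {Z : Type} (S : Z → ℝ) (z : Z) : ℂ :=
  Complex.exp (Complex.I * ((S z / hbar : ℝ) : ℂ))

/-- The `L²` pairing `∫ conj f · g` of the kinematical Hilbert space `L²(Z, dz)`. -/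
def l2 {Z : Type} [MeasureSpace Z] (f g : Z → ℂ) : ℂ := ∫ z, conj (f z) * g z

section Schroedinger

variable {Z : Type} [NormedAddCommGroup Z] [NormedSpace ℝ Z]

/-- The operator `p̂_v + ∂_v S` with `p̂_v = - i ħ ∂_v`, in the direction `v`. -/
def shiftedMomentum (hbar : ℝ) (S : Z → ℝ) (v : Z) (f : Z → ℂ) : Z → ℂ := fun z =>
  -(Complex.I * (hbar : ℂ)) * lineDeriv ℝ f z v + ((lineDeriv ℝ S z v : ℝ) : ℂ) * f z

/-- `χ` is the Schwartz function `e^{i S / ħ} f`. For `S = 0` (and for every `S` of temperate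
growth) the functions `f` which admit such a `χ` are exactly the Schwartz functions. -/
def IsLift (hbar : ℝ) (S : Z → ℝ) (f : Z → ℂ) (χ : 𝓢(Z, ℂ)) : Prop :=
  ∀ z, χ z = phase hbar S z * f z

/-- `∑ F i = g`, where `e^{i S / ħ} F i` and `e^{i S / ħ} g` are Schwartz functions and the sum
converges unconditionally in the Schwartz topology. -/
def TestHasSum (hbar : ℝ) (S : Z → ℝ) {κ : Type} (F : κ → Z → ℂ) (g : Z → ℂ) : Prop :=
  ∃ (χ : κ → 𝓢(Z, ℂ)) (η : 𝓢(Z, ℂ)),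
    (∀ i, IsLift hbar S (F i) (χ i)) ∧ IsLift hbar S g η ∧ HasSum χ η

/-- `dF/dt = g` at `t = 0`, the derivative being taken in the Schwartz topology (after
multiplication by `e^{i S / ħ}`). -/
def TestHasDerivAtZero (hbar : ℝ) (S : Z → ℝ) (F : ℝ → Z → ℂ) (g : Z → ℂ) : Prop :=
  ∃ (χ : ℝ → 𝓢(Z, ℂ)) (η : 𝓢(Z, ℂ)),
    (∀ t, IsLift hbar S (F t) (χ t)) ∧ IsLift hbar S g η ∧
      Tendsto (fun t : ℝ => t⁻¹ • (χ t - χ 0)) (𝓝[≠] 0) (𝓝 η)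

end Schroedinger

/-! ### Quantum constraints, group averaging and the physical Hilbert space -/

/-- A finite family of commuting self-adjoint quantum constraints `Ĉ_i` on `L²(Z, dz)`, for which
group averaging converges. The constraints are given on a common invariant dense domain `Φ` of
kinematical test states (on which they are essentially self-adjoint, `Φ` being invariant under the
unitary group), together with the unitary group `V s = exp (i ∑ s_i Ĉ_i / ħ)` which they generate
and which is determined by them.
The real function `S` only fixes the class of test states: `e^{i S / ħ} f` is a Schwartz function
for each `f ∈ Φ`. -/
structure ConstraintSystem (hbar : ℝ) {Z : Type} [NormedAddCommGroup Z] [NormedSpace ℝ Z]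
    [MeasureSpace Z] (S : Z → ℝ) {κ : Type} [Fintype κ] [DecidableEq κ]
    (C : κ → (Z → ℂ) → (Z → ℂ)) where
  /-- the kinematical test states -/
  Φ : Submodule ℂ (Z → ℂ)
  hbar_pos : 0 < hbar
  continuous_action : Continuous S
  exists_lift : ∀ f ∈ Φ, ∃ χ : 𝓢(Z, ℂ), IsLift hbar S f χ
  /-- `Φ` is dense in `L²(Z, dz)` -/
  dense : ∀ g : Z → ℂ, MemLp g 2 volume → (∀ f ∈ Φ, l2 f g = 0) → g =ᵐ[volume] 0
  /-- the constraints map test states to test states -/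
  constraint_mem : ∀ i, ∀ f ∈ Φ, C i f ∈ Φ
  /-- the unitary group `exp (i ∑ s_i Ĉ_i / ħ)` -/
  V : (κ → ℝ) → Φ →ₗ[ℂ] Φ
  V_zero : ∀ f, V 0 f = f
  V_add : ∀ s t f, V (s + t) f = V s (V t f)
  V_isometry : ∀ s (f g : Φ), l2 (V s f : Z → ℂ) (V s g) = l2 (f : Z → ℂ) g
  V_continuous : ∀ f g : Φ, Continuous fun s => l2 (f : Z → ℂ) (V s g)
  /-- `V` is generated by the constraints -/
  V_generator : ∀ i (f : Φ), TestHasDerivAtZero hbar S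
    (fun t => (V (Pi.single i t) f : Z → ℂ)) (fun z => Complex.I / (hbar : ℂ) * C i f z)
  /-- the group average converges as a function -/
  avg_pointwise : ∀ (f : Φ) z, Integrable fun s : κ → ℝ => (V s f : Z → ℂ) z
  /-- the matrix elements of the group average converge -/
  avg_pairing : ∀ f g : Φ,
    Integrable fun q : (κ → ℝ) × Z => conj ((f : Z → ℂ) q.2) * (V q.1 g : Z → ℂ) q.2

/-- A function `ψ`, in general not square integrable, solves the constraint `Ĉ`: it is annihilated
by `Ĉ` acting by duality, `⟨Ĉ f | ψ⟩ = 0` for all test states `f`. -/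
def Annihilates {Z : Type} [MeasureSpace Z] (Φ : Submodule ℂ (Z → ℂ))
    (C : (Z → ℂ) → (Z → ℂ)) (ψ : Z → ℂ) : Prop :=
  ∀ f ∈ Φ, Integrable (fun z => conj (C f z) * ψ z) ∧ l2 (C f) ψ = 0

namespace ConstraintSystem

variable {hbar : ℝ} {Z : Type} [NormedAddCommGroup Z] [NormedSpace ℝ Z]
  [MeasureSpace Z] {S : Z → ℝ} {κ : Type} [Fintype κ] [DecidableEq κ]
  {C : κ → (Z → ℂ) → (Z → ℂ)}

/-- The improper projector `ℙ = ∏ δ(Ĉ_i)`, `δ(Ĉ) = (2πħ)⁻¹ ∫ ds e^{i s Ĉ / ħ}`, as a linear map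
from test states to functions. -/
def avg (Q : ConstraintSystem hbar S C) : Q.Φ →ₗ[ℂ] (Z → ℂ) where
  toFun f := fun z => (((2 * Real.pi * hbar : ℝ) : ℂ) ^ Fintype.card κ)⁻¹ *
    ∫ s : κ → ℝ, (Q.V s f : Z → ℂ) z
  map_add' f g := by
    funext z
    simp only [map_add, Submodule.coe_add, Pi.add_apply]
    rw [integral_add (Q.avg_pointwise f z) (Q.avg_pointwise g z), mul_add]
  map_smul' a f := by
    funext z
    simp only [map_smul, Submodule.coe_smul, Pi.smul_apply, smul_eq_mul, RingHom.id_apply]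
    rw [integral_const_mul]
    ring

/-- The physical states `ψ = ℙ f`, `f ∈ Φ`, as wave functions. -/
def PhysState (Q : ConstraintSystem hbar S C) : Type := LinearMap.range Q.avg

instance (Q : ConstraintSystem hbar S C) : AddCommGroup Q.PhysState :=
  inferInstanceAs (AddCommGroup (LinearMap.range Q.avg))

instance (Q : ConstraintSystem hbar S C) : Module ℂ Q.PhysState :=
  inferInstanceAs (Module ℂ (LinearMap.range Q.avg))

/-- The wave function of a physical state. -/
def wave (Q : ConstraintSystem hbar S C) : Q.PhysState →ₗ[ℂ] (Z → ℂ) :=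
  (LinearMap.range Q.avg).subtype

/-- The improper projector as a map onto the physical states. -/
def proj (Q : ConstraintSystem hbar S C) : Q.Φ →ₗ[ℂ] Q.PhysState := Q.avg.rangeRestrict

/-- A kinematical representative of a physical state. -/
def rep (Q : ConstraintSystem hbar S C) (ψ : Q.PhysState) : Q.Φ := Classical.choose ψ.2

lemma avg_rep (Q : ConstraintSystem hbar S C) (ψ : Q.PhysState) :
    Q.avg (Q.rep ψ) = Q.wave ψ := Classical.choose_spec ψ.2

section Hilbert

variable [FiniteDimensional ℝ Z] [BorelSpace Z] [(volume : Measure Z).IsAddHaarMeasure]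

lemma norm_phase (hbar : ℝ) {Z : Type} (S : Z → ℝ) (z : Z) : ‖phase hbar S z‖ = 1 := by
  rw [phase, mul_comm, Complex.norm_exp_ofReal_mul_I]

lemma memLp (Q : ConstraintSystem hbar S C) (f : Q.Φ) : MemLp (f : Z → ℂ) 2 volume := by
  obtain ⟨χ, hχ⟩ := Q.exists_lift f f.2
  have hc : Continuous (phase hbar S) := by
    have := Q.continuous_action
    unfold phase
    fun_prop
  have hne : ∀ z, phase hbar S z ≠ 0 := fun z => Complex.exp_ne_zero _
  have hf : (f : Z → ℂ) = fun z => (phase hbar S z)⁻¹ * χ z := by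
    funext z
    rw [hχ z, inv_mul_cancel_left₀ (hne z)]
  have hcont : Continuous (f : Z → ℂ) := by
    rw [hf]
    exact (hc.inv₀ hne).mul χ.continuous
  refine (memLp_congr_norm hcont.aestronglyMeasurable χ.continuous.aestronglyMeasurable ?_).2
    (χ.memLp 2 volume)
  refine Eventually.of_forall fun z => ?_
  rw [hχ z, norm_mul, norm_phase, one_mul]

lemma integrable_l2 (Q : ConstraintSystem hbar S C) (f g : Q.Φ) :
    Integrable fun z => conj ((f : Z → ℂ) z) * (g : Z → ℂ) z :=
  (Q.memLp f).star.integrable_mul (Q.memLp g)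

/-- A test state as an element of the kinematical Hilbert space. -/
def vec (Q : ConstraintSystem hbar S C) (f : Q.Φ) : Lp ℂ 2 (volume : Measure Z) :=
  (Q.memLp f).toLp

lemma inner_vec (Q : ConstraintSystem hbar S C) (f g : Q.Φ) :
    inner ℂ (Q.vec f) (Q.vec g) = l2 (f : Z → ℂ) g := by
  rw [L2.inner_def, l2]
  refine integral_congr_ae ?_
  filter_upwards [(Q.memLp f).coeFn_toLp, (Q.memLp g).coeFn_toLp] with z h1 h2
  rw [vec, vec, h1, h2, RCLike.inner_apply, mul_comm]

lemma l2_V (Q : ConstraintSystem hbar S C) (f g : Q.Φ) (s t : κ → ℝ) :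
    l2 (Q.V s f : Z → ℂ) (Q.V t g) = l2 (f : Z → ℂ) (Q.V (t - s) g) := by
  rw [← Q.V_isometry s f (Q.V (t - s) g), ← Q.V_add, add_sub_cancel]

lemma l2_conj (f g : Z → ℂ) : conj (l2 f g) = l2 g f := by
  rw [l2, l2, ← integral_conj]
  refine integral_congr_ae (Eventually.of_forall fun z => ?_)
  simp [mul_comm]

/-- The kinematical matrix elements of the improper projector. -/
lemma l2_avg (Q : ConstraintSystem hbar S C) (f g : Q.Φ) :
    l2 (f : Z → ℂ) (Q.avg g) = (((2 * Real.pi * hbar : ℝ) : ℂ) ^ Fintype.card κ)⁻¹ *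
      ∫ s : κ → ℝ, l2 (f : Z → ℂ) (Q.V s g) := by
  have h := integral_integral_swap
    (f := fun s z => conj ((f : Z → ℂ) z) * (Q.V s g : Z → ℂ) z) (Q.avg_pairing f g)
  simp only [l2]
  rw [h, ← integral_const_mul]
  refine integral_congr_ae (Eventually.of_forall fun z => ?_)
  simp only [avg, LinearMap.coe_mk, AddHom.coe_mk]
  rw [integral_const_mul]
  ring

lemma l2_avg_conj (Q : ConstraintSystem hbar S C) (f g : Q.Φ) :
    conj (l2 (g : Z → ℂ) (Q.avg f)) = l2 (f : Z → ℂ) (Q.avg g) := by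
  rw [l2_avg, l2_avg, map_mul, ← integral_conj]
  congr 1
  · rw [map_inv₀, map_pow, Complex.conj_ofReal]
  · rw [← integral_neg_eq_self]
    refine integral_congr_ae (Eventually.of_forall fun s => ?_)
    simp only
    rw [l2_conj]
    have := Q.l2_V f g (-s) 0
    rw [zero_sub, neg_neg, Q.V_zero] at this
    rw [this]

lemma continuous_vec (Q : ConstraintSystem hbar S C) (f : Q.Φ) :
    Continuous fun s => Q.vec (Q.V s f) := by
  rw [continuous_iff_continuousAt]
  intro s
  have hsub : ∀ t, ‖Q.vec (Q.V t f) - Q.vec (Q.V s f)‖ ^ 2 =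
      2 * (l2 (f : Z → ℂ) f).re - 2 * (l2 (f : Z → ℂ) (Q.V (s - t) f)).re := by
    intro t
    have h1 : ∀ t, ‖Q.vec (Q.V t f)‖ ^ 2 = (l2 (f : Z → ℂ) f).re := by
      intro t
      rw [@norm_sq_eq_re_inner ℂ, inner_vec, Q.V_isometry]
      rfl
    rw [@norm_sub_sq ℂ, h1, h1, inner_vec, l2_V]
    simp only [RCLike.re_to_complex]
    ring
  have hlim : Tendsto (fun t => ‖Q.vec (Q.V t f) - Q.vec (Q.V s f)‖ ^ 2) (𝓝 s) (𝓝 0) := by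
    simp only [hsub]
    have hc : Continuous fun t =>
        2 * (l2 (f : Z → ℂ) f).re - 2 * (l2 (f : Z → ℂ) (Q.V (s - t) f)).re := by
      have := (Q.V_continuous f f).comp (continuous_const.sub continuous_id : Continuous fun t => s - t)
      exact continuous_const.sub (continuous_const.mul (Complex.continuous_re.comp this))
    have := hc.tendsto s
    simpa [Q.V_zero] using this
  rw [ContinuousAt, tendsto_iff_norm_sub_tendsto_zero]
  have := hlim.sqrt
  simpa using this

lemma integrable_matrix (Q : ConstraintSystem hbar S C) (f g : Q.Φ) :
    Integrable fun s => l2 (f : Z → ℂ) (Q.V s g) :=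
  (Q.avg_pairing f g).integral_prod_left

/-- A Gaussian weight. -/
def gauss (κ : Type) [Fintype κ] (r : ℝ) (s : κ → ℝ) : ℝ := ∏ i, Real.exp (-r * s i ^ 2)

lemma continuous_gauss (r : ℝ) : Continuous (gauss κ r) := by
  unfold gauss
  fun_prop

lemma gauss_pos (r : ℝ) (s : κ → ℝ) : 0 < gauss κ r s :=
  Finset.prod_pos fun _ _ => Real.exp_pos _

lemma gauss_le_one {r : ℝ} (hr : 0 ≤ r) (s : κ → ℝ) : gauss κ r s ≤ 1 := by
  refine Finset.prod_le_one (fun _ _ => (Real.exp_pos _).le) fun i _ => ?_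
  rw [Real.exp_le_one_iff]
  nlinarith [mul_nonneg hr (sq_nonneg (s i))]

lemma integrable_gauss {r : ℝ} (hr : 0 < r) : Integrable (gauss κ r) :=
  Integrable.fintype_prod (f := fun (_ : κ) (v : ℝ) => Real.exp (-r * v ^ 2))
    fun _ => integrable_exp_neg_mul_sq hr

lemma gauss_mul (r : ℝ) (s u : κ → ℝ) :
    gauss κ r s * gauss κ r (u + s) =
      gauss κ (2 * r) (s + (1 / 2 : ℝ) • u) * gauss κ (r / 2) u := by
  unfold gauss
  rw [← Finset.prod_mul_distrib, ← Finset.prod_mul_distrib]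
  refine Finset.prod_congr rfl fun i _ => ?_
  rw [← Real.exp_add, ← Real.exp_add]
  congr 1
  simp only [Pi.add_apply, Pi.smul_apply, smul_eq_mul]
  ring

lemma re_integral_gauss_nonneg (Q : ConstraintSystem hbar S C) (f : Q.Φ) {r : ℝ} (hr : 0 < r) :
    0 ≤ (∫ u : κ → ℝ, (gauss κ (r / 2) u : ℂ) * l2 (f : Z → ℂ) (Q.V u f)).re := by
  set w := gauss κ r with hw
  set a : (κ → ℝ) → ℂ := fun u => l2 (f : Z → ℂ) (Q.V u f) with ha
  set F : (κ → ℝ) → Lp ℂ 2 (volume : Measure Z) := fun s => (w s : ℂ) • Q.vec (Q.V s f) with hF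
  have hn : ∀ s, ‖Q.vec (Q.V s f)‖ = ‖Q.vec f‖ := by
    intro s
    rw [@norm_eq_sqrt_re_inner ℂ, @norm_eq_sqrt_re_inner ℂ, inner_vec, inner_vec, Q.V_isometry]
  have hwc : Continuous w := continuous_gauss r
  have hFi : Integrable F := by
    refine Integrable.mono' ((integrable_gauss (κ := κ) hr).mul_const ‖Q.vec f‖)
      ((Complex.continuous_ofReal.comp hwc).smul (Q.continuous_vec f)).aestronglyMeasurable
      (Eventually.of_forall fun s => ?_)
    rw [hF, norm_smul, hn, Complex.norm_real, Real.norm_of_nonneg (gauss_pos r s).le]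
  have hai : Integrable a := Q.integrable_matrix f f
  set c : ℝ := ∫ s, gauss κ (2 * r) s with hc
  have hcpos : 0 < c := by
    rw [hc, integral_pos_iff_support_of_nonneg (fun s => (gauss_pos _ s).le)
      (integrable_gauss (by positivity))]
    have : Function.support (gauss κ (2 * r)) = Set.univ :=
      Set.eq_univ_of_forall fun s => (gauss_pos _ s).ne'
    rw [this]
    exact Measure.measure_univ_pos.2 (NeZero.ne _)
  have h1 : ∀ s, inner ℂ (F s) (∫ t, F t) = ∫ u, ((w s * w (u + s) : ℝ) : ℂ) * a u := by
    intro s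
    rw [← integral_inner hFi, ← integral_add_right_eq_self _ s]
    refine integral_congr_ae (Eventually.of_forall fun u => ?_)
    simp only [hF]
    rw [inner_smul_left, inner_smul_right, inner_vec, l2_V, add_sub_cancel_right, Complex.conj_ofReal]
    push_cast
    ring
  have hprod : Integrable (fun q : (κ → ℝ) × (κ → ℝ) => ((w q.1 * w (q.2 + q.1) : ℝ) : ℂ) * a q.2)
      (volume.prod volume) := by
    have h0 : Integrable (fun q : (κ → ℝ) × (κ → ℝ) => (w q.1 : ℂ) * a q.2)
      (volume.prod volume) := (integrable_gauss (κ := κ) hr).ofReal.mul_prod hai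
    refine h0.norm.mono' ?_ (Eventually.of_forall fun q => ?_)
    · refine AEStronglyMeasurable.mul ?_ hai.aestronglyMeasurable.comp_snd
      exact Continuous.aestronglyMeasurable (by fun_prop)
    · rw [norm_mul, norm_mul, Complex.norm_real, Complex.norm_real, norm_mul]
      have h2 : ‖w (q.2 + q.1)‖ ≤ 1 := by
        rw [Real.norm_of_nonneg (gauss_pos r _).le]
        exact gauss_le_one hr.le _
      have := mul_le_mul_of_nonneg_left h2 (norm_nonneg (w q.1))
      rw [mul_one] at this
      exact mul_le_mul_of_nonneg_right this (norm_nonneg _)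
  have h3 : inner ℂ (∫ t, F t) (∫ t, F t) =
      conj ((c : ℂ) * ∫ u, (gauss κ (r / 2) u : ℂ) * a u) := by
    have h4 : inner ℂ (∫ t, F t) (∫ t, F t) = conj (∫ s, inner ℂ (F s) (∫ t, F t)) := by
      rw [← integral_inner hFi, ← integral_conj]
      refine integral_congr_ae (Eventually.of_forall fun s => ?_)
      simp only [inner_conj_symm]
    rw [h4]
    congr 1
    simp only [h1]
    rw [integral_integral_swap hprod, ← integral_const_mul]
    refine integral_congr_ae (Eventually.of_forall fun u => ?_)
    simp only [hw, gauss_mul]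
    rw [integral_mul_const, integral_complex_ofReal, integral_mul_const,
      integral_add_right_eq_self (gauss κ (2 * r)) ((1 / 2 : ℝ) • u), ← hc]
    push_cast
    ring
  have h5 : 0 ≤ (inner ℂ (∫ t, F t) (∫ t, F t)).re := inner_self_nonneg (𝕜 := ℂ)
  rw [h3, Complex.conj_re, Complex.re_ofReal_mul] at h5
  exact nonneg_of_mul_nonneg_right h5 hcpos

/-- Group averaging is positive. -/
lemma re_integral_matrix_nonneg (Q : ConstraintSystem hbar S C) (f : Q.Φ) :
    0 ≤ (∫ u : κ → ℝ, l2 (f : Z → ℂ) (Q.V u f)).re := by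
  have hai := Q.integrable_matrix f f
  have hlim : Tendsto (fun n : ℕ => ∫ u : κ → ℝ,
      (gauss κ ((1 / ((n : ℝ) + 1)) / 2) u : ℂ) * l2 (f : Z → ℂ) (Q.V u f)) atTop
      (𝓝 (∫ u : κ → ℝ, l2 (f : Z → ℂ) (Q.V u f))) := by
    refine tendsto_integral_of_dominated_convergence
      (fun u => ‖l2 (f : Z → ℂ) (Q.V u f)‖) (fun n => ?_) hai.norm (fun n => ?_) ?_
    · exact (Complex.continuous_ofReal.comp (continuous_gauss _)).aestronglyMeasurable.mul
        hai.aestronglyMeasurable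
    · refine Eventually.of_forall fun u => ?_
      rw [norm_mul, Complex.norm_real, Real.norm_of_nonneg (gauss_pos _ _).le]
      exact mul_le_of_le_one_left (norm_nonneg _) (gauss_le_one (by positivity) _)
    · refine Eventually.of_forall fun u => ?_
      have hg : Continuous fun r : ℝ => gauss κ (r / 2) u := by
        unfold gauss
        fun_prop
      have h0 : Tendsto (fun n : ℕ => gauss κ ((1 / ((n : ℝ) + 1)) / 2) u) atTop (𝓝 1) := by
        have := (hg.tendsto 0).comp (tendsto_one_div_add_atTop_nhds_zero_nat (𝕜 := ℝ))
        simpa [gauss, Function.comp_def] using this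
      have h1 := ((Complex.continuous_ofReal.tendsto 1).comp h0).mul_const
        (l2 (f : Z → ℂ) (Q.V u f))
      simpa using h1
  exact ge_of_tendsto ((Complex.continuous_re.tendsto _).comp hlim)
    (Eventually.of_forall fun n => Q.re_integral_gauss_nonneg f (by positivity))


lemma l2_wave (Q : ConstraintSystem hbar S C) (f : Q.Φ) (ψ φ : Q.PhysState)
    (h : Q.avg f = Q.wave ψ) : l2 (f : Z → ℂ) (Q.wave φ) = l2 (Q.rep ψ : Z → ℂ) (Q.wave φ) := by
  rw [← Q.avg_rep φ, ← Q.l2_avg_conj, ← Q.l2_avg_conj (Q.rep ψ), h, Q.avg_rep]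

lemma integrable_wave (Q : ConstraintSystem hbar S C) (f : Q.Φ) (φ : Q.PhysState) :
    Integrable fun z => conj ((f : Z → ℂ) z) * Q.wave φ z := by
  rw [← Q.avg_rep φ]
  refine ((Q.avg_pairing f (Q.rep φ)).integral_prod_right.const_mul
    (((2 * Real.pi * hbar : ℝ) : ℂ) ^ Fintype.card κ)⁻¹).congr
    (Eventually.of_forall fun z => ?_)
  simp only [avg, LinearMap.coe_mk, AddHom.coe_mk]
  rw [integral_const_mul]
  ring

/-- The physical inner product `⟨ψ | φ⟩ = ⟨f | ℙ | g⟩` of `ψ = ℙ f` and `φ = ℙ g`. -/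
@[reducible] def core (Q : ConstraintSystem hbar S C) : PreInnerProductSpace.Core ℂ Q.PhysState where
  inner ψ φ := l2 (Q.rep ψ : Z → ℂ) (Q.wave φ)
  conj_inner_symm ψ φ := by
    rw [← Q.avg_rep φ, ← Q.avg_rep ψ, Q.l2_avg_conj]
  re_inner_nonneg ψ := by
    have h := Q.re_integral_matrix_nonneg (Q.rep ψ)
    have hp : 0 < 2 * Real.pi * hbar := mul_pos Real.two_pi_pos Q.hbar_pos
    rw [← Q.avg_rep ψ, Q.l2_avg, ← Complex.ofReal_pow, ← Complex.ofReal_inv,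
      RCLike.re_to_complex, Complex.re_ofReal_mul]
    positivity
  add_left ψ φ χ := by
    have h : Q.avg (Q.rep ψ + Q.rep φ) = Q.wave (ψ + φ) := by
      rw [map_add, map_add, Q.avg_rep, Q.avg_rep]
    rw [← Q.l2_wave _ _ χ h]
    simp only [l2]
    rw [← integral_add (Q.integrable_wave _ _) (Q.integrable_wave _ _)]
    refine integral_congr_ae (Eventually.of_forall fun z => ?_)
    simp only [Submodule.coe_add, Pi.add_apply, map_add]
    ring
  smul_left ψ φ a := by
    have h : Q.avg (a • Q.rep ψ) = Q.wave (a • ψ) := by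
      rw [map_smul, map_smul, Q.avg_rep]
    rw [← Q.l2_wave _ _ φ h]
    simp only [l2]
    rw [← integral_const_mul]
    refine integral_congr_ae (Eventually.of_forall fun z => ?_)
    simp only [Submodule.coe_smul, Pi.smul_apply, smul_eq_mul, map_mul]
    ring

instance (Q : ConstraintSystem hbar S C) : SeminormedAddCommGroup Q.PhysState :=
  @InnerProductSpace.Core.toSeminormedAddCommGroup ℂ Q.PhysState _ _ _ Q.core

instance (Q : ConstraintSystem hbar S C) : InnerProductSpace ℂ Q.PhysState :=
  InnerProductSpace.ofCore Q.core

/-- The physical inner product may be computed with any kinematical representative. -/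
lemma inner_proj (Q : ConstraintSystem hbar S C) (f : Q.Φ) (φ : Q.PhysState) :
    inner ℂ (Q.proj f) φ = l2 (f : Z → ℂ) (Q.wave φ) :=
  (Q.l2_wave f (Q.proj f) φ rfl).symm

/-- The physical Hilbert space: the completion of the physical states with respect to the physical
inner product (states of norm zero being identified with zero). -/
abbrev PhysSpace (Q : ConstraintSystem hbar S C) : Type := UniformSpace.Completion Q.PhysState

end Hilbert

end ConstraintSystem

/-- A densely defined map between physical Hilbert spaces, given on the physical states, is unitary
if it extends to a unitary map between the physical Hilbert spaces. -/
def IsUnitary {hbar : ℝ} {Z W κ ι : Type}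
    [NormedAddCommGroup Z] [NormedSpace ℝ Z] [FiniteDimensional ℝ Z] [MeasureSpace Z] [BorelSpace Z]
    [(volume : Measure Z).IsAddHaarMeasure]
    [NormedAddCommGroup W] [NormedSpace ℝ W] [FiniteDimensional ℝ W] [MeasureSpace W] [BorelSpace W]
    [(volume : Measure W).IsAddHaarMeasure]
    [Fintype κ] [DecidableEq κ] [Fintype ι] [DecidableEq ι]
    {S : Z → ℝ} {T : W → ℝ} {C : κ → (Z → ℂ) → (Z → ℂ)} {D : ι → (W → ℂ) → (W → ℂ)}
    {Q : ConstraintSystem hbar S C} {Q₁ : ConstraintSystem hbar T D}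
    (u : Q.PhysState →ₗ[ℂ] Q₁.PhysState) : Prop :=
  ∃ v : Q.PhysSpace ≃ₗᵢ[ℂ] Q₁.PhysSpace,
    ∀ ψ : Q.PhysState, v (ψ : Q.PhysSpace) = (u ψ : Q₁.PhysSpace)

/-! ### Moves of type II -/

/-- The configurations `(x^e, x^b)` at step `k + 1`. -/
abbrev CfgNew (e b : Type) : Type := (e → ℝ) × (b → ℝ)

/-- The configurations `(x^o, x^e, x^b)` at step `k`. The old variables `x^o = (x^α, x^β)` are
split according to the two kinds of pre-constraints to which they belong. -/
abbrev CfgOld (α β e b : Type) : Type := (α → ℝ) × (β → ℝ) × CfgNew e b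

instance {e b : Type} [Fintype e] [Fintype b] :
    (volume : Measure (CfgNew e b)).IsAddHaarMeasure :=
  Measure.prod.instIsAddHaarMeasure _ _

instance {α β e b : Type} [Fintype α] [Fintype β] [Fintype e] [Fintype b] :
    (volume : Measure (CfgOld α β e b)).IsAddHaarMeasure :=
  @Measure.prod.instIsAddHaarMeasure _ _ _ _ _ _ _ _ volume volume _
    (Measure.prod.instIsAddHaarMeasure _ _) _ _ _ _

section TypeII

variable {α β e b : Type} [Fintype α] [DecidableEq α] [Fintype β] [DecidableEq β]
  [Fintype e] [DecidableEq e] [Fintype b] [DecidableEq b]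

/-- The action contribution `S(x^o, x^e)` of the move as a function of all variables at `k`. -/
def actionOld (S : (α → ℝ) × (β → ℝ) × (e → ℝ) → ℝ) (x : CfgOld α β e b) : ℝ :=
  S (x.1, x.2.1, x.2.2.1)

/-- The coordinate directions of the old variables. -/
def oldDir : α ⊕ β → CfgOld α β e b
  | Sum.inl i => (Pi.single i 1, 0, 0, 0)
  | Sum.inr i => (0, Pi.single i 1, 0, 0)

/-- The pre-constraints `Ĉ_o = p̂_o + ∂S/∂x^o` at step `k`. -/
def preConstraint (hbar : ℝ) (S : (α → ℝ) × (β → ℝ) × (e → ℝ) → ℝ) (o : α ⊕ β) :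
    (CfgOld α β e b → ℂ) → (CfgOld α β e b → ℂ) :=
  shiftedMomentum hbar (actionOld S) (oldDir o)

/-- The unitary group `e^{i t · Ĉ / ħ} = e^{- i S / ħ} e^{i t · p̂ / ħ} e^{i S / ħ}` of the
pre-constraints, `t = (t^α, t^β)`, acting on functions. -/
def preFlow (hbar : ℝ) (S : (α → ℝ) × (β → ℝ) × (e → ℝ) → ℝ) (t : (α → ℝ) × (β → ℝ))
    (ψ : CfgOld α β e b → ℂ) : CfgOld α β e b → ℂ := fun x =>
  conj (phase hbar (actionOld S) x) *
    (phase hbar (actionOld S) (x.1 + t.1, x.2.1 + t.2, x.2.2) * ψ (x.1 + t.1, x.2.1 + t.2, x.2.2))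

/-- The improper projector `ℙ^B = ∏_β δ(Ĉ_β)`. -/
def projB (hbar : ℝ) (S : (α → ℝ) × (β → ℝ) × (e → ℝ) → ℝ) (ψ : CfgOld α β e b → ℂ) :
    CfgOld α β e b → ℂ := fun x =>
  (((2 * Real.pi * hbar : ℝ) : ℂ) ^ Fintype.card β)⁻¹ *
    ∫ t : β → ℝ, preFlow hbar S (0, t) ψ x

/-- The canonical variables in which post-constraints are expanded: the positions `x^e`, `x^b`
and the momenta of all variables. -/
inductive Letter (α β e b : Type) : Type
  | xe (i : e)
  | xb (i : b)
  | pOld (i : α ⊕ β)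
  | pe (i : e)
  | pb (i : b)

/-- The operators at step `k`: the positions and the updated momenta `p̂ + ∂S/∂x`. -/
def oldLetter (hbar : ℝ) (S : (α → ℝ) × (β → ℝ) × (e → ℝ) → ℝ) :
    Letter α β e b → (CfgOld α β e b → ℂ) → (CfgOld α β e b → ℂ)
  | .xe i => fun f x => (x.2.2.1 i : ℂ) * f x
  | .xb i => fun f x => (x.2.2.2 i : ℂ) * f x
  | .pOld i => shiftedMomentum hbar (actionOld S) (oldDir i)
  | .pe i => shiftedMomentum hbar (actionOld S) (0, 0, Pi.single i 1, 0)
  | .pb i => shiftedMomentum hbar (actionOld S) (0, 0, 0, Pi.single i 1)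

/-- The operators at step `k + 1`: positions and momenta; the momenta of the old variables,
which no longer occur, vanish there. -/
def newLetter (hbar : ℝ) : Letter α β e b → (CfgNew e b → ℂ) → (CfgNew e b → ℂ)
  | .xe i => fun f y => (y.1 i : ℂ) * f y
  | .xb i => fun f y => (y.2 i : ℂ) * f y
  | .pOld _ => fun _ _ => 0
  | .pe i => shiftedMomentum hbar (fun _ => 0) (Pi.single i 1, 0)
  | .pb i => shiftedMomentum hbar (fun _ => 0) (0, Pi.single i 1)

/-- The operator of an ordered monomial. -/
def wordOp {L Z : Type} (op : L → (Z → ℂ) → (Z → ℂ)) : List L → (Z → ℂ) → (Z → ℂ)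
  | [], f => f
  | l :: w, f => op l (wordOp op w f)

/-- The operator of an ordered power series with coefficients `c`. -/
def seriesOp {L Z : Type} (op : L → (Z → ℂ) → (Z → ℂ)) (c : List L → ℂ) (f : Z → ℂ) : Z → ℂ :=
  fun z => ∑' w, c w * wordOp op w f z

/-- The constraint `Ĉ^k` at step `k` with the given power series. -/
def oldConstraint (hbar : ℝ) (S : (α → ℝ) × (β → ℝ) × (e → ℝ) → ℝ)
    (c : List (Letter α β e b) → ℂ) : (CfgOld α β e b → ℂ) → (CfgOld α β e b → ℂ) :=
  seriesOp (oldLetter hbar S) c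

/-- The time-evolved constraint `Ĉ^{k+1}` at step `k + 1`: momentum updating replaces
`p̂ + ∂S/∂x` at step `k` by `p̂` at step `k + 1`. -/
def newConstraint (hbar : ℝ) (c : List (Letter α β e b) → ℂ) :
    (CfgNew e b → ℂ) → (CfgNew e b → ℂ) :=
  seriesOp (newLetter hbar) c

/-- The power series `c` defines an operator `Φ → Φ` at step `k`, the series converging on `Φ` in
the Schwartz topology. -/
def SeriesOn (hbar : ℝ) (S : (α → ℝ) × (β → ℝ) × (e → ℝ) → ℝ)
    (Φ : Submodule ℂ (CfgOld α β e b → ℂ)) (c : List (Letter α β e b) → ℂ) : Prop :=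
  ∀ f ∈ Φ, oldConstraint hbar S c f ∈ Φ ∧
    TestHasSum hbar (actionOld S) (fun w x => c w * wordOp (oldLetter hbar S) w f x)
      (oldConstraint hbar S c f)

/-- All post-constraints at step `k`: those pre-constraints `Ĉ_α` which are also post-constraints,
and a family of further post-constraints given by power series. -/
def postConstraint (hbar : ℝ) (S : (α → ℝ) × (β → ℝ) × (e → ℝ) → ℝ) {ι : Type}
    (c : ι → List (Letter α β e b) → ℂ) :
    α ⊕ ι → (CfgOld α β e b → ℂ) → (CfgOld α β e b → ℂ)
  | Sum.inl i => preConstraint hbar S (Sum.inl i)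
  | Sum.inr j => oldConstraint hbar S (c j)

/-- `∫ dx^o e^{i S / ħ} f`, the kinematical state at step `k + 1` obtained from `f`. -/
def integrateOld (hbar : ℝ) (S : (α → ℝ) × (β → ℝ) × (e → ℝ) → ℝ) (f : CfgOld α β e b → ℂ) :
    CfgNew e b → ℂ := fun y =>
  ∫ q : (α → ℝ) × (β → ℝ), phase hbar (actionOld S) (q.1, q.2, y) * f (q.1, q.2, y)

/-- The Faddeev-Popov regularized state updating map
`(2πħ)^{K_α} ∫ ∏_o dx^o ∏_α δ(x'^α - x^α) M e^{i S / ħ} ψ` with constant measure `M` and gauge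
fixing parameters `x'`. -/
def update (hbar : ℝ) (S : (α → ℝ) × (β → ℝ) × (e → ℝ) → ℝ) (M : ℂ) (x' : α → ℝ)
    (ψ : CfgOld α β e b → ℂ) : CfgNew e b → ℂ := fun y =>
  ((2 * Real.pi * hbar : ℝ) : ℂ) ^ Fintype.card α *
    ∫ q : (α → ℝ) × (β → ℝ), M * phase hbar (actionOld S) (q.1, q.2, y) * ψ (q.1, q.2, y)
      ∂((Measure.dirac x').prod volume)

variable {hbar : ℝ} {S : (α → ℝ) × (β → ℝ) × (e → ℝ) → ℝ} {ι : Type} [Fintype ι] [DecidableEq ι]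
  {c : ι → List (Letter α β e b) → ℂ}

/-- The kinematical domains of a type II move: the pre-constraints and their unitary groups act on
the test states at step `k`, the test states at step `k + 1` are the functions
`∫ dx^o e^{i S / ħ} f` for test states `f` at step `k`, and the integrals over the old variables in
the state updating and in the improper projection of post-physical states onto the pre-constraints
converge absolutely. -/
structure MoveDomain
    (Q : ConstraintSystem hbar (actionOld (b := b) S) (postConstraint hbar S c))
    (Q₁ : ConstraintSystem hbar (fun _ : CfgNew e b => (0 : ℝ)) fun j => newConstraint hbar (c j)) :
    Prop where
  pre_mem : ∀ o, ∀ f ∈ Q.Φ, preConstraint hbar S o f ∈ Q.Φ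
  flow_mem : ∀ t, ∀ f ∈ Q.Φ, preFlow hbar S t f ∈ Q.Φ
  mem_new : ∀ h, h ∈ Q₁.Φ ↔ ∃ f ∈ Q.Φ, h = integrateOld hbar S f
  integrable_update : ∀ (f : Q.Φ) (xα : α → ℝ) (y : CfgNew e b),
    Integrable fun q : (α ⊕ ι → ℝ) × (β → ℝ) => (Q.V q.1 f : CfgOld α β e b → ℂ) (xα, q.2, y)
  integrable_projB : ∀ (f : Q.Φ) (ψ : Q.PhysState),
    Integrable fun q : (β → ℝ) × CfgOld α β e b =>
      conj ((f : CfgOld α β e b → ℂ) q.2) * preFlow hbar S (0, q.1) (Q.wave ψ) q.2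

/-- A pre-constraint `Ĉ_i`, `i ∈ β`, is non-trivial (it does not annihilate all post-physical
states at step `k`) and first class. -/
def IsNontrivialFirstClass
    (Q : ConstraintSystem hbar (actionOld (b := b) S) (postConstraint hbar S c)) (i : β) : Prop :=
  (∃ ψ : Q.PhysState, ¬ Annihilates Q.Φ (preConstraint hbar S (Sum.inr i)) (Q.wave ψ)) ∧
  ∀ j, ∀ f ∈ Q.Φ, preConstraint hbar S (Sum.inr i) (postConstraint hbar S c j f) =
    postConstraint hbar S c j (preConstraint hbar S (Sum.inr i) f)

end TypeII

end QMove

end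

open QMove

noncomputable section

namespace QMove

/-! Multiplication by `e^{iS/ħ}` turns every `p̂ + ∂S/∂x` into `p̂`. In this picture (`lift`) the
pre-constraints generate translations of `x^o`, which commute with every canonical variable that
enters the post-constraints, because `x^o` is not among these variables.

The central object is `I f = ∫ dx^o e^{iS/ħ} f`, a linear surjection from the test states at `k` to
those at `k+1`. It kills `Ĉ_o f`, an integral of a total derivative, and carries each updated
canonical variable to its counterpart at `k+1`. By continuity on Schwartz space it carries
convergent power series to power series (`newConstraint_integrateOld`). Since a symmetric generator
determines its group, it also intertwines the unitary groups (`MoveDomain.integrate_V`).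

In `ℙ f` the averaging over the `α`-parameters translates `x^α`. Together with the integral over
`x^β` in `𝔲` it therefore sweeps out all of `x^o`, whatever the gauge-fixing value, and `𝔲 ℙ f = M ℙ
I f` (`update_avg`). Replacing the integral over `x^β` by `ℙ^B` gives, in the same way, `e^{iS/ħ}
ℙ^B ℙ g = (2πħ)^{-K} ℙ I g`, where the projector on the right is that of step `k+1`. Pairing with
`f` and applying Fubini yields the inner product formula (`l2_projB`, `inner_updateMap`).

For empty `β`, `ℙ^B` is the identity. With the stated `|M|` the map is then isometric with full
range on physical states, so it extends to a unitary. For nonempty `β`, `ℙ^B ψ` solves all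
pre-constraints (`l2_preConstraint_projB`). If inner products were preserved, `⟨Ĉ_β f|ψ⟩` would be a
multiple of `⟨Ĉ_β f|ℙ^B ψ⟩ = 0` for all `f` and `ψ`, contradicting the non-triviality of `Ĉ_β`. -/

theorem integral_eq_zero_of_hasLineDerivAt {E : Type*} [NormedAddCommGroup E] [NormedSpace ℝ E]
    [FiniteDimensional ℝ E] [MeasurableSpace E] [BorelSpace E] {μ : Measure E}
    [μ.IsAddHaarMeasure] {f f' : E → ℂ} {v : E} (hf : Integrable f μ) (hf' : Integrable f' μ)
    (h : ∀ x, HasLineDerivAt ℝ f (f' x) x v) : ∫ x, f' x ∂μ = 0 := by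
  -- Integration by parts against the constant function 1.
  have := integral_bilinear_hasLineDerivAt_right_eq_neg_left_of_integrable (μ := μ)
    (f := f) (f' := f') (g := fun _ => (1 : ℂ)) (g' := fun _ => 0) (v := v)
    (B := ContinuousLinearMap.mul ℝ ℂ) (by simpa using hf') (by simp) (by simpa using hf)
    (fun x _ => h x) (fun x _ => hasDerivAt_const _ _)
  simpa using this

lemma phase_ne_zero (hbar : ℝ) {Z : Type} (S : Z → ℝ) (z : Z) : phase hbar S z ≠ 0 :=
  Complex.exp_ne_zero _

lemma conj_phase_mul_phase (hbar : ℝ) {Z : Type} (S : Z → ℝ) (z : Z) :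
    conj (phase hbar S z) * phase hbar S z = 1 := by
  rw [mul_comm, Complex.mul_conj, Complex.normSq_eq_norm_sq, ConstraintSystem.norm_phase]
  simp

lemma phase_mul_conj_phase (hbar : ℝ) {Z : Type} (S : Z → ℝ) (z : Z) :
    phase hbar S z * conj (phase hbar S z) = 1 := by
  rw [mul_comm, conj_phase_mul_phase]

lemma phase_mul_injective {hbar : ℝ} {Z : Type} {S : Z → ℝ} {f g : Z → ℂ}
    (h : ∀ z, phase hbar S z * f z = phase hbar S z * g z) : f = g :=
  funext fun z => mul_left_cancel₀ (phase_ne_zero hbar S z) (h z)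

lemma phase_zero (hbar : ℝ) {Z : Type} (z : Z) : phase hbar (fun _ : Z => (0 : ℝ)) z = 1 := by
  simp [phase]

/-! ### Constraint systems: lifts, symmetry of the generators, uniqueness of the generated group. -/

namespace ConstraintSystem

variable {hbar : ℝ} {Z : Type} [NormedAddCommGroup Z] [NormedSpace ℝ Z]
  [MeasureSpace Z] {S : Z → ℝ} {κ : Type} [Fintype κ] [DecidableEq κ]
  {C : κ → (Z → ℂ) → (Z → ℂ)}

/-- The Schwartz function `e^{i S / ħ} f` of a test state `f`. -/
def lift (Q : ConstraintSystem hbar S C) : Q.Φ →ₗ[ℂ] 𝓢(Z, ℂ) where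
  toFun f := Classical.choose (Q.exists_lift f f.2)
  map_add' f g := by
    ext z
    rw [add_apply, Classical.choose_spec (Q.exists_lift f f.2),
      Classical.choose_spec (Q.exists_lift g g.2),
      Classical.choose_spec (Q.exists_lift (f + g : Q.Φ) (f + g).2), Submodule.coe_add,
      Pi.add_apply, mul_add]
  map_smul' a f := by
    ext z
    rw [RingHom.id_apply, smul_apply, Classical.choose_spec (Q.exists_lift f f.2),
      Classical.choose_spec (Q.exists_lift (a • f : Q.Φ) (a • f).2), Submodule.coe_smul,
      Pi.smul_apply, smul_eq_mul, smul_eq_mul, mul_left_comm]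

lemma lift_apply (Q : ConstraintSystem hbar S C) (f : Q.Φ) (z : Z) :
    Q.lift f z = phase hbar S z * (f : Z → ℂ) z :=
  Classical.choose_spec (Q.exists_lift f f.2) z

/-- Lifts are unique, so the Schwartz functions hidden in the existentials of `TestHasSum` and
`TestHasDerivAtZero` can be replaced by `lift`. -/
lemma lift_eq (Q : ConstraintSystem hbar S C) (f : Q.Φ) {χ : 𝓢(Z, ℂ)}
    (h : IsLift hbar S (f : Z → ℂ) χ) : χ = Q.lift f := by
  ext z
  rw [h z, lift_apply]

lemma lift_injective (Q : ConstraintSystem hbar S C) : Function.Injective Q.lift := fun f g h =>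
  Subtype.ext <| phase_mul_injective (hbar := hbar) (S := S) fun z => by
    rw [← lift_apply, ← lift_apply, h]

/-- The constraints as maps on the test states. -/
def op (Q : ConstraintSystem hbar S C) (i : κ) (f : Q.Φ) : Q.Φ := ⟨C i f, Q.constraint_mem i f f.2⟩

lemma tendsto_lift_V (Q : ConstraintSystem hbar S C) (i : κ) (f : Q.Φ) :
    Tendsto (fun t : ℝ => t⁻¹ • (Q.lift (Q.V (Pi.single i t) f) - Q.lift f)) (𝓝[≠] 0)
      (𝓝 ((Complex.I / (hbar : ℂ)) • Q.lift (Q.op i f))) := by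
  obtain ⟨χ, η, h1, h2, h3⟩ := Q.V_generator i f
  have hχ : ∀ t, χ t = Q.lift (Q.V (Pi.single i t) f) := fun t => Q.lift_eq _ (h1 t)
  have hη : η = (Complex.I / (hbar : ℂ)) • Q.lift (Q.op i f) := by
    ext z
    rw [h2 z, smul_apply, lift_apply, smul_eq_mul, mul_left_comm]
    rfl
  have h0 : χ 0 = Q.lift f := by rw [hχ, Pi.single_zero, Q.V_zero]
  rw [h0, hη] at h3
  simpa only [hχ] using h3

lemma V_single_add (Q : ConstraintSystem hbar S C) (i : κ) (s t : ℝ) (f : Q.Φ) :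
    Q.V (Pi.single i (s + t)) f = Q.V (Pi.single i t) (Q.V (Pi.single i s) f) := by
  rw [← Q.V_add, ← Pi.single_add, add_comm]

/-- Continuous linear images of the orbits of the constraints are differentiable. -/
lemma hasDerivAt_V (Q : ConstraintSystem hbar S C) {G : Type*} [NormedAddCommGroup G]
    [NormedSpace ℂ G] [NormedSpace ℝ G] [IsScalarTower ℝ ℂ G] (A : 𝓢(Z, ℂ) →L[ℂ] G) (i : κ)
    (f : Q.Φ) (t : ℝ) :
    HasDerivAt (fun t : ℝ => A (Q.lift (Q.V (Pi.single i t) f)))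
      ((Complex.I / (hbar : ℂ)) • A (Q.lift (Q.op i (Q.V (Pi.single i t) f)))) t := by
  rw [hasDerivAt_iff_tendsto_slope_zero]
  -- By the group law, the difference quotient at `t` is the one at 0 for the test state already
  -- moved by `t`.
  have h := (A.continuous.tendsto _).comp (Q.tendsto_lift_V i (Q.V (Pi.single i t) f))
  rw [map_smul] at h
  refine h.congr fun s => ?_
  rw [Function.comp_apply, ← Q.V_single_add]
  exact (LinearMap.map_smul_of_tower A.toLinearMap _ _).trans (congrArg _ (map_sub A _ _))

section Hilbert

variable [FiniteDimensional ℝ Z] [BorelSpace Z] [(volume : Measure Z).IsAddHaarMeasure]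

/-- The phases cancel in the pairing. Hence derivatives of lifts, mapped to `L²`, differentiate the
matrix elements `l2`. -/
lemma inner_toLp_lift (Q : ConstraintSystem hbar S C) (f g : Q.Φ) :
    inner ℂ (SchwartzMap.toLpCLM ℂ ℂ 2 volume (Q.lift f))
      (SchwartzMap.toLpCLM ℂ ℂ 2 volume (Q.lift g)) = l2 (f : Z → ℂ) g := by
  rw [L2.inner_def, l2]
  refine integral_congr_ae ?_
  filter_upwards [(Q.lift f).coeFn_toLp 2 volume, (Q.lift g).coeFn_toLp 2 volume] with z h1 h2
  rw [SchwartzMap.toLpCLM_apply, SchwartzMap.toLpCLM_apply, h1, h2, RCLike.inner_apply,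
    lift_apply, lift_apply, map_mul]
  linear_combination (conj ((f : Z → ℂ) z) * (g : Z → ℂ) z) * phase_mul_conj_phase hbar S z

/-- Density gives equality almost everywhere, and continuity of the lifts upgrades it to equality
everywhere. -/
lemma eq_of_l2_eq (Q : ConstraintSystem hbar S C) (f g : Q.Φ)
    (h : ∀ k : Q.Φ, l2 (k : Z → ℂ) f = l2 (k : Z → ℂ) g) : f = g := by
  have h0 : ((f - g : Q.Φ) : Z → ℂ) =ᵐ[volume] 0 := by
    refine Q.dense _ (Q.memLp _) fun k hk => ?_
    have := h ⟨k, hk⟩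
    rw [← inner_toLp_lift, ← inner_toLp_lift] at this
    rw [← inner_toLp_lift Q ⟨k, hk⟩, map_sub, map_sub, inner_sub_right, this, sub_self]
  apply Q.lift_injective
  rw [← sub_eq_zero, ← map_sub]
  ext z
  refine congrFun ((Continuous.ae_eq_iff_eq volume (Q.lift (f - g)).continuous
    (continuous_const (y := (0 : ℂ)))).1 ?_) z
  filter_upwards [h0] with z hz
  rw [lift_apply, hz, Pi.zero_apply, mul_zero]

/-- The constraints are symmetric. -/
lemma l2_op (Q : ConstraintSystem hbar S C) (i : κ) (f g : Q.Φ) :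
    l2 (Q.op i f : Z → ℂ) g = l2 (f : Z → ℂ) (Q.op i g) := by
  -- By isometry `⟨V_t f | V_t g⟩` is constant in `t`; its derivative at 0 is the commutation of
  -- `Ĉ_i` across the pairing.
  have h := (Q.hasDerivAt_V (SchwartzMap.toLpCLM ℂ ℂ 2 volume) i f 0).inner ℂ
    (Q.hasDerivAt_V (SchwartzMap.toLpCLM ℂ ℂ 2 volume) i g 0)
  simp only [inner_toLp_lift, Q.V_isometry, Pi.single_zero, Q.V_zero, inner_smul_left,
    inner_smul_right] at h
  have h1 := h.unique (hasDerivAt_const _ _)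
  have hb : (hbar : ℂ) ≠ 0 := Complex.ofReal_ne_zero.2 Q.hbar_pos.ne'
  simp only [map_div₀, Complex.conj_I, Complex.conj_ofReal] at h1
  field_simp at h1
  linear_combination -(mul_eq_zero.1 (h1.trans (mul_zero _))).resolve_left Complex.I_ne_zero

/-- The unitary group generated by a constraint is determined by it. -/
lemma eq_V_of_hasDerivAt (Q : ConstraintSystem hbar S C) (i : κ) (q : ℝ → Q.Φ)
    (h : ∀ t, HasDerivAt (fun t => SchwartzMap.toLpCLM ℂ ℂ 2 volume (Q.lift (q t)))
      ((Complex.I / (hbar : ℂ)) • SchwartzMap.toLpCLM ℂ ℂ 2 volume (Q.lift (Q.op i (q t)))) t)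
    (t : ℝ) : q t = Q.V (Pi.single i t) (q 0) := by
  -- The pairing of two solutions of the same Schrödinger equation is constant, because the
  -- generator is symmetric.
  have key : ∀ k : Q.Φ, l2 (Q.V (Pi.single i t) k : Z → ℂ) (q t) = l2 (k : Z → ℂ) (q 0) := by
    intro k
    have hd : ∀ t, HasDerivAt (fun t => l2 (Q.V (Pi.single i t) k : Z → ℂ) (q t)) 0 t := by
      intro t
      have := (Q.hasDerivAt_V (SchwartzMap.toLpCLM ℂ ℂ 2 volume) i k t).inner ℂ (h t)
      simp only [inner_toLp_lift, inner_smul_left, inner_smul_right, l2_op] at this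
      refine this.congr_deriv ?_
      simp only [map_div₀, Complex.conj_I, Complex.conj_ofReal]
      ring
    have := is_const_of_deriv_eq_zero (fun t => (hd t).differentiableAt) (fun t => (hd t).deriv) t 0
    simpa only [Pi.single_zero, Q.V_zero] using this
  refine Q.eq_of_l2_eq _ _ fun k => ?_
  have hk : Q.V (Pi.single i t) (Q.V (Pi.single i (-t)) k) = k := by
    rw [← Q.V_single_add, neg_add_cancel, Pi.single_zero, Q.V_zero]
  rw [← hk, key, Q.V_isometry]

/-- The matrix elements of a constraint are total derivatives along its orbits. -/
lemma integral_l2_op (Q : ConstraintSystem hbar S C) (i : κ) (f g : Q.Φ) :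
    ∫ s : κ → ℝ, l2 (Q.op i f : Z → ℂ) (Q.V s g) = 0 := by
  have hb : (hbar : ℂ) ≠ 0 := Complex.ofReal_ne_zero.2 Q.hbar_pos.ne'
  -- The derivative of `⟨f | V_s g⟩` in the direction `s_i` is `(i/ħ) ⟨Ĉ_i f | V_s g⟩`; the group
  -- law reduces it to a derivative at 0 of the orbit of `V_s g`.
  have h := integral_eq_zero_of_hasLineDerivAt (μ := volume) (v := Pi.single i (1 : ℝ))
    (Q.integrable_matrix f g)
    ((Q.integrable_matrix (Q.op i f) g).const_mul (Complex.I / (hbar : ℂ))) fun s => by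
      have h := (hasDerivAt_const (0 : ℝ) (SchwartzMap.toLpCLM ℂ ℂ 2 volume (Q.lift f))).inner ℂ
        (Q.hasDerivAt_V (SchwartzMap.toLpCLM ℂ ℂ 2 volume) i (Q.V s g) 0)
      simp only [inner_toLp_lift, inner_smul_right, inner_zero_left, add_zero, Pi.single_zero,
        Q.V_zero, ← Q.l2_op] at h
      refine h.congr_of_eventuallyEq (Eventually.of_forall fun t => ?_)
      simp only
      rw [← Q.V_add, add_comm, ← Pi.single_smul', smul_eq_mul, mul_one]
  rw [integral_const_mul] at h
  exact (mul_eq_zero.1 h).resolve_left (div_ne_zero Complex.I_ne_zero hb)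

/-- Physical states solve the constraints. -/
lemma annihilates_wave (Q : ConstraintSystem hbar S C) (i : κ) (ψ : Q.PhysState) :
    Annihilates Q.Φ (C i) (Q.wave ψ) := by
  intro f hf
  refine ⟨Q.integrable_wave (Q.op i ⟨f, hf⟩) ψ, ?_⟩
  have := Q.l2_avg (Q.op i ⟨f, hf⟩) (Q.rep ψ)
  rw [Q.integral_l2_op, mul_zero, Q.avg_rep] at this
  exact this

lemma proj_rep (Q : ConstraintSystem hbar S C) (ψ : Q.PhysState) : Q.proj (Q.rep ψ) = ψ :=
  Subtype.ext (Q.avg_rep ψ)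

lemma wave_proj (Q : ConstraintSystem hbar S C) (f : Q.Φ) : Q.wave (Q.proj f) = Q.avg f := rfl

lemma wave_injective (Q : ConstraintSystem hbar S C) : Function.Injective Q.wave :=
  Subtype.val_injective

/-- Cauchy–Schwarz for the physical semi-inner product, since pairing with `f` is the physical
product with `ℙ f`. -/
lemma l2_wave_eq_zero (Q : ConstraintSystem hbar S C) {ψ : Q.PhysState} (h : ‖ψ‖ = 0) (f : Q.Φ) :
    l2 (f : Z → ℂ) (Q.wave ψ) = 0 := by
  rw [← Q.inner_proj, ← norm_eq_zero]
  refine le_antisymm ((norm_inner_le_norm _ _).trans ?_) (norm_nonneg _)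
  rw [h, mul_zero]

end Hilbert

end ConstraintSystem

/-! ### Weights, the gauge transformation by the phase, and integration of Schwartz functions over
the old variables. -/

/-- An integrable weight `(1 + ‖x‖) ^ (-n)`, `n = dim E + 1`. -/
def weight (E : Type*) [NormedAddCommGroup E] [NormedSpace ℝ E] (x : E) : ℝ :=
  ((1 + ‖x‖) ^ (Module.finrank ℝ E + 1))⁻¹

section Weight

variable {E : Type*} [NormedAddCommGroup E] [NormedSpace ℝ E]

lemma weight_pos (x : E) : 0 < weight E x := by
  unfold weight
  positivity

lemma weight_le_one (x : E) : weight E x ≤ 1 :=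
  inv_le_one_of_one_le₀ (one_le_pow₀ (le_add_of_nonneg_right (norm_nonneg x)))

lemma continuous_weight : Continuous (weight E) := by
  unfold weight
  exact Continuous.inv₀ (by fun_prop) fun x => by positivity

variable [FiniteDimensional ℝ E] [MeasurableSpace E] [BorelSpace E] (μ : Measure E)
  [μ.IsAddHaarMeasure]

lemma integrable_weight : Integrable (weight E) μ := by
  have h := integrable_one_add_norm (E := E) (μ := μ) (r := ((Module.finrank ℝ E + 1 : ℕ) : ℝ))
    (by push_cast; linarith)
  refine h.congr (Eventually.of_forall fun x => ?_)
  simp only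
  rw [Real.rpow_neg (by positivity), Real.rpow_natCast, weight]

lemma memLp_weight : MemLp (weight E) 2 μ := by
  rw [memLp_two_iff_integrable_sq continuous_weight.aestronglyMeasurable]
  refine (integrable_weight μ).mono' (continuous_weight.pow 2).aestronglyMeasurable
    (Eventually.of_forall fun x => ?_)
  rw [Real.norm_of_nonneg (sq_nonneg _), sq]
  exact mul_le_of_le_one_left (weight_pos x).le (weight_le_one x)

end Weight

/-- Product rule for `χ = e^{iS/ħ} f`: the derivative of the phase contributes `(i/ħ) ∂_v S`, which
`-iħ` turns into `∂_v S`. -/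
lemma phase_mul_shiftedMomentum {hbar : ℝ} (hb : hbar ≠ 0) {Z : Type} [NormedAddCommGroup Z]
    [NormedSpace ℝ Z] {S : Z → ℝ} (hS : Differentiable ℝ S) {f χ : Z → ℂ}
    (hχ : Differentiable ℝ χ) (h : ∀ z, χ z = phase hbar S z * f z) (v z : Z) :
    phase hbar S z * shiftedMomentum hbar S v f z =
      -(Complex.I * (hbar : ℂ)) * lineDeriv ℝ χ z v := by
  have hbc : (hbar : ℂ) ≠ 0 := Complex.ofReal_ne_zero.2 hb
  have hp : Differentiable ℝ (phase hbar S) := by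
    unfold phase
    fun_prop
  have hf : Differentiable ℝ f := by
    have : f = fun z => (phase hbar S z)⁻¹ * χ z := funext fun z => by
      rw [h z, inv_mul_cancel_left₀ (phase_ne_zero hbar S z)]
    rw [this]
    exact (hp.inv fun z => phase_ne_zero hbar S z).mul hχ
  have hdp : HasLineDerivAt ℝ (phase hbar S)
      (phase hbar S z * (Complex.I * ((lineDeriv ℝ S z v / hbar : ℝ) : ℂ))) z v := by
    have h1 : HasDerivAt (fun t : ℝ => S (z + t • v)) (lineDeriv ℝ S z v) 0 :=
      (hS z).lineDifferentiableAt.hasLineDerivAt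
    have h2 := ((h1.div_const hbar).ofReal_comp.const_mul Complex.I).cexp
    simpa [HasLineDerivAt, phase] using h2
  have hdf : HasLineDerivAt ℝ f (lineDeriv ℝ f z v) z v :=
    (hf z).lineDifferentiableAt.hasLineDerivAt
  have hd := (HasDerivAt.fun_mul (c := fun t : ℝ => phase hbar S (z + t • v))
    (d := fun t : ℝ => f (z + t • v)) hdp hdf).congr_of_eventuallyEq
    (Eventually.of_forall fun t => h (z + t • v))
  rw [HasLineDerivAt.lineDeriv hd, shiftedMomentum]
  simp only [zero_smul, add_zero]
  push_cast
  field_simp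
  linear_combination (phase hbar S z * f z * ((lineDeriv ℝ S z v : ℝ) : ℂ)) * Complex.I_sq

section TypeII

variable {α β e b : Type} [Fintype α] [DecidableEq α] [Fintype β] [DecidableEq β]
  [Fintype e] [DecidableEq e] [Fintype b] [DecidableEq b]

/-- The integral over the old variables. -/
def marginal (χ : CfgOld α β e b → ℂ) (y : CfgNew e b) : ℂ :=
  ∫ q : (α → ℝ) × (β → ℝ), χ (q.1, q.2, y)

/-- The order of the seminorms which bound the integral over the old variables. -/
def marginalOrder (α β e b : Type) [Fintype α] [Fintype β] [Fintype e] [Fintype b] : ℕ :=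
  (Module.finrank ℝ ((α → ℝ) × (β → ℝ)) + 1) + (Module.finrank ℝ (CfgNew e b) + 1)

/-- The seminorm which bounds the integral over the old variables. -/
def marginalSeminorm (α β e b : Type) [Fintype α] [Fintype β] [Fintype e] [Fintype b] :
    Seminorm ℂ 𝓢(CfgOld α β e b, ℂ) :=
  (Finset.Iic (marginalOrder α β e b, 0)).sup (schwartzSeminormFamily ℂ (CfgOld α β e b) ℂ)

/-- The Schwartz decay is split between old and new variables, each having norm at most that of the
full configuration. Both weights are integrable, so one bound serves to integrate over `x^o` and to
control the result pointwise and in `L²`. -/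
lemma exists_norm_schwartz_le : ∃ K : ℝ, 0 ≤ K ∧ ∀ (χ : 𝓢(CfgOld α β e b, ℂ))
    (q : (α → ℝ) × (β → ℝ)) (y : CfgNew e b), ‖χ (q.1, q.2, y)‖ ≤
      K * marginalSeminorm α β e b χ * (weight ((α → ℝ) × (β → ℝ)) q * weight (CfgNew e b) y) := by
  -- The power of 2 is the constant of `SchwartzMap.one_add_le_sup_seminorm_apply`.
  refine ⟨2 ^ marginalOrder α β e b, by positivity, fun χ q y => ?_⟩
  have h := SchwartzMap.one_add_le_sup_seminorm_apply (𝕜 := ℂ)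
    (m := (marginalOrder α β e b, 0)) le_rfl le_rfl χ (q.1, q.2, y)
  rw [norm_iteratedFDeriv_zero] at h
  nth_rewrite 1 [marginalOrder] at h
  rw [pow_add] at h
  have hq : ‖q‖ ≤ ‖((q.1, q.2, y) : CfgOld α β e b)‖ := by
    simp only [Prod.norm_def]
    exact max_le_max le_rfl (le_max_left _ _)
  have hy : ‖y‖ ≤ ‖((q.1, q.2, y) : CfgOld α β e b)‖ := by
    simp only [Prod.norm_def]
    exact le_max_of_le_right (le_max_right _ _)
  unfold weight
  rw [← mul_inv, ← div_eq_mul_inv, le_div_iff₀ (by positivity), mul_comm]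
  refine le_trans ?_ h
  gcongr

lemma integrable_schwartz_old (χ : 𝓢(CfgOld α β e b, ℂ)) (y : CfgNew e b) :
    Integrable fun q : (α → ℝ) × (β → ℝ) => χ (q.1, q.2, y) := by
  obtain ⟨K, -, h⟩ := exists_norm_schwartz_le (α := α) (β := β) (e := e) (b := b)
  refine Integrable.mono' (((integrable_weight volume).mul_const (weight _ y)).const_mul
    (K * marginalSeminorm α β e b χ)) (Continuous.aestronglyMeasurable (by fun_prop))
    (Eventually.of_forall fun q => h χ q y)

lemma exists_norm_marginal_le : ∃ K : ℝ, 0 ≤ K ∧ ∀ (χ : 𝓢(CfgOld α β e b, ℂ))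
    (y : CfgNew e b), ‖marginal χ y‖ ≤
      K * marginalSeminorm α β e b χ * weight (CfgNew e b) y := by
  obtain ⟨K, hK, h⟩ := exists_norm_schwartz_le (α := α) (β := β) (e := e) (b := b)
  refine ⟨K * ∫ q, weight ((α → ℝ) × (β → ℝ)) q,
    mul_nonneg hK (integral_nonneg fun q => (weight_pos q).le), fun χ y => ?_⟩
  refine (norm_integral_le_of_norm_le (((integrable_weight volume).mul_const
    (weight _ y)).const_mul (K * marginalSeminorm α β e b χ))
    (Eventually.of_forall fun q => h χ q y)).trans_eq ?_
  rw [integral_const_mul, integral_mul_const]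
  ring

lemma marginal_add (χ η : 𝓢(CfgOld α β e b, ℂ)) (y : CfgNew e b) :
    marginal (χ + η : 𝓢(CfgOld α β e b, ℂ)) y = marginal χ y + marginal η y :=
  integral_add (integrable_schwartz_old χ y) (integrable_schwartz_old η y)

lemma marginal_smul (a : ℂ) (χ : 𝓢(CfgOld α β e b, ℂ)) (y : CfgNew e b) :
    marginal (a • χ : 𝓢(CfgOld α β e b, ℂ)) y = a * marginal χ y :=
  integral_const_mul _ _

/-- The integral over the old variables at a point, on Schwartz functions. -/
def marginalEval (y : CfgNew e b) : 𝓢(CfgOld α β e b, ℂ) →L[ℂ] ℂ :=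
  SchwartzMap.mkCLMtoNormedSpace (fun χ => marginal χ y) (fun χ η => marginal_add χ η y)
    (fun a χ => marginal_smul a χ y) <| by
    obtain ⟨K, hK, h⟩ := exists_norm_marginal_le (α := α) (β := β) (e := e) (b := b)
    refine ⟨Finset.Iic (marginalOrder α β e b, 0), K, hK, fun χ => (h χ y).trans ?_⟩
    exact mul_le_of_le_one_right (mul_nonneg hK (apply_nonneg _ _)) (weight_le_one y)

lemma marginalEval_apply (y : CfgNew e b) (χ : 𝓢(CfgOld α β e b, ℂ)) :
    marginalEval y χ = marginal χ y := rfl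

lemma memLp_marginal (χ : 𝓢(CfgOld α β e b, ℂ)) :
    MemLp (marginal χ) 2 (volume : Measure (CfgNew e b)) := by
  obtain ⟨K, hK, h⟩ := exists_norm_marginal_le (α := α) (β := β) (e := e) (b := b)
  have hm : AEStronglyMeasurable (marginal χ) (volume : Measure (CfgNew e b)) := by
    have hc : Continuous fun p : CfgNew e b × ((α → ℝ) × (β → ℝ)) => χ (p.2.1, p.2.2, p.1) := by
      fun_prop
    exact hc.stronglyMeasurable.integral_prod_right.aestronglyMeasurable
  refine (memLp_weight (volume : Measure (CfgNew e b))).of_le_mul hm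
    (Eventually.of_forall fun y => ?_) (c := K * marginalSeminorm α β e b χ)
  rw [Real.norm_of_nonneg (weight_pos y).le]
  exact h χ y

/-- The integral over the old variables as a map from Schwartz functions to `L²`. -/
def marginalLp : 𝓢(CfgOld α β e b, ℂ) →L[ℂ] Lp ℂ 2 (volume : Measure (CfgNew e b)) :=
  SchwartzMap.mkCLMtoNormedSpace (fun χ => (memLp_marginal χ).toLp)
    (fun χ η => by
      rw [← MemLp.toLp_add]
      congr 1
      exact funext (marginal_add χ η))
    (fun a χ => by
      rw [RingHom.id_apply, ← MemLp.toLp_const_smul]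
      congr 1
      exact funext (marginal_smul a χ)) <| by
    obtain ⟨K, hK, h⟩ := exists_norm_marginal_le (α := α) (β := β) (e := e) (b := b)
    refine ⟨Finset.Iic (marginalOrder α β e b, 0),
      K * ‖(memLp_weight (volume : Measure (CfgNew e b))).toLp‖,
      mul_nonneg hK (norm_nonneg _), fun χ => ?_⟩
    refine (Lp.norm_le_mul_norm_of_ae_le_mul (c := K * marginalSeminorm α β e b χ)
      (g := (memLp_weight (volume : Measure (CfgNew e b))).toLp) ?_).trans_eq
      (mul_right_comm _ _ _)
    filter_upwards [(memLp_marginal χ).coeFn_toLp,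
      (memLp_weight (volume : Measure (CfgNew e b))).coeFn_toLp] with y h1 h2
    rw [h1, h2, Real.norm_of_nonneg (weight_pos y).le]
    exact h χ y

lemma hasLineDerivAt_schwartz {Z : Type*} [NormedAddCommGroup Z] [NormedSpace ℝ Z]
    (χ : 𝓢(Z, ℂ)) (z v : Z) : HasLineDerivAt ℝ χ (LineDeriv.lineDerivOp v χ z) z v := by
  rw [SchwartzMap.lineDerivOp_apply]
  exact χ.differentiableAt.lineDifferentiableAt.hasLineDerivAt

lemma hasDerivAt_schwartz {Z : Type*} [NormedAddCommGroup Z] [NormedSpace ℝ Z]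
    (χ : 𝓢(Z, ℂ)) (z v : Z) (t : ℝ) :
    HasDerivAt (fun t : ℝ => χ (z + t • v)) (LineDeriv.lineDerivOp v χ (z + t • v)) t := by
  rw [hasDerivAt_iff_tendsto_slope_zero]
  have h := hasDerivAt_iff_tendsto_slope_zero.1 (hasLineDerivAt_schwartz χ (z + t • v) v)
  refine h.congr fun s => ?_
  rw [zero_add, zero_smul, add_zero, add_smul, add_assoc]

lemma hasLineDerivAt_marginal (χ : 𝓢(CfgOld α β e b, ℂ)) (y v : CfgNew e b) :
    HasLineDerivAt ℝ (marginal χ)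
      (marginal (LineDeriv.lineDerivOp ((0, 0, v) : CfgOld α β e b) χ) y) y v := by
  set η := LineDeriv.lineDerivOp ((0, 0, v) : CfgOld α β e b) χ with hη
  obtain ⟨K, hK, h⟩ := exists_norm_schwartz_le (α := α) (β := β) (e := e) (b := b)
  have := (hasDerivAt_integral_of_dominated_loc_of_deriv_le (μ := volume) (x₀ := (0 : ℝ))
    (s := Set.univ)
    (F := fun (t : ℝ) (q : (α → ℝ) × (β → ℝ)) => χ (q.1, q.2, y + t • v))
    (F' := fun (t : ℝ) (q : (α → ℝ) × (β → ℝ)) => η (q.1, q.2, y + t • v))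
    -- Uniform in `t`, because the weight in the new variables is at most 1.
    (bound := fun q => K * marginalSeminorm α β e b η * weight ((α → ℝ) × (β → ℝ)) q)
    univ_mem (Eventually.of_forall fun t => (integrable_schwartz_old χ _).aestronglyMeasurable)
    (integrable_schwartz_old χ _) (integrable_schwartz_old η _).aestronglyMeasurable
    (Eventually.of_forall fun q t _ => (h η q _).trans ?_)
    ((integrable_weight _).const_mul _) (Eventually.of_forall fun q t _ => ?_)).2
  · simpa [HasLineDerivAt, marginal] using this
  · exact mul_le_mul_of_nonneg_left (mul_le_of_le_one_right (weight_pos q).le (weight_le_one _))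
      (mul_nonneg hK (apply_nonneg _ _))
  · simpa using hasDerivAt_schwartz χ (q.1, q.2, y) (0, 0, v) t

/-- A derivative along an integrated direction is a total derivative. This is why the old momenta
become 0 at step `k+1`. -/
lemma marginal_lineDerivOp_old (χ : 𝓢(CfgOld α β e b, ℂ)) (w : (α → ℝ) × (β → ℝ))
    (y : CfgNew e b) :
    marginal (LineDeriv.lineDerivOp ((w.1, w.2, 0) : CfgOld α β e b) χ) y = 0 := by
  refine integral_eq_zero_of_hasLineDerivAt (v := w) (integrable_schwartz_old χ y)
    (integrable_schwartz_old _ y) fun q => ?_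
  refine HasDerivAt.congr_of_eventuallyEq (hasLineDerivAt_schwartz χ (q.1, q.2, y) (w.1, w.2, 0))
    (Eventually.of_forall fun t => ?_)
  simp

end TypeII

/-! ### Momentum updating, and the translations generated by the pre-constraints. -/

section TypeII

variable {α β e b : Type} [Fintype α] [DecidableEq α] [Fintype β] [DecidableEq β]
  [Fintype e] [DecidableEq e] [Fintype b] [DecidableEq b]
  {hbar : ℝ} {S : (α → ℝ) × (β → ℝ) × (e → ℝ) → ℝ}

lemma differentiable_actionOld (hS : ContDiff ℝ ∞ S) :
    Differentiable ℝ (actionOld S : CfgOld α β e b → ℝ) :=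
  (hS.differentiable (by simp)).comp (by fun_prop :
    Differentiable ℝ fun x : CfgOld α β e b => (x.1, x.2.1, x.2.2.1))

lemma integrateOld_eq_marginal {f : CfgOld α β e b → ℂ} {χ : CfgOld α β e b → ℂ}
    (h : ∀ x, χ x = phase hbar (actionOld S) x * f x) : integrateOld hbar S f = marginal χ :=
  funext fun _ => integral_congr_ae (Eventually.of_forall fun _ => (h _).symm)

lemma phase_mul_preFlow (t : (α → ℝ) × (β → ℝ)) (f : CfgOld α β e b → ℂ) (x : CfgOld α β e b) :
    phase hbar (actionOld S) x * preFlow hbar S t f x =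
      phase hbar (actionOld S) (x + (t.1, t.2, 0)) * f (x + (t.1, t.2, 0)) := by
  have hx : ((x.1 + t.1, x.2.1 + t.2, x.2.2) : CfgOld α β e b) = x + (t.1, t.2, 0) := by
    simp [Prod.ext_iff]
  rw [preFlow, hx, ← mul_assoc, phase_mul_conj_phase, one_mul]

lemma isLift_shiftedMomentum (hb : hbar ≠ 0) (hS : ContDiff ℝ ∞ S) {f : CfgOld α β e b → ℂ}
    {χ : 𝓢(CfgOld α β e b, ℂ)} (h : IsLift hbar (actionOld S) f χ) (v : CfgOld α β e b) :
    IsLift hbar (actionOld S) (shiftedMomentum hbar (actionOld S) v f)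
      (-(Complex.I * (hbar : ℂ)) • LineDeriv.lineDerivOp v χ) := fun z => by
  rw [phase_mul_shiftedMomentum hb (differentiable_actionOld hS) χ.differentiable h, smul_apply,
    SchwartzMap.lineDerivOp_apply, smul_eq_mul]

lemma exists_isLift_mul (g : CfgOld α β e b →L[ℝ] ℝ) {f : CfgOld α β e b → ℂ}
    {χ : 𝓢(CfgOld α β e b, ℂ)} (h : IsLift hbar (actionOld S) f χ) :
    ∃ χ', IsLift hbar (actionOld S) (fun x => (g x : ℂ) * f x) χ' := by
  refine ⟨SchwartzMap.smulLeftCLM ℂ (fun x => (g x : ℂ)) χ, fun z => ?_⟩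
  have hg : (fun x => (g x : ℂ)).HasTemperateGrowth :=
    (Complex.ofRealCLM ∘L g).hasTemperateGrowth
  rw [SchwartzMap.smulLeftCLM_apply_apply hg, h z, smul_eq_mul, mul_left_comm]

lemma exists_isLift_oldLetter (hb : hbar ≠ 0) (hS : ContDiff ℝ ∞ S) (l : Letter α β e b)
    {f : CfgOld α β e b → ℂ} {χ : 𝓢(CfgOld α β e b, ℂ)} (h : IsLift hbar (actionOld S) f χ) :
    ∃ χ', IsLift hbar (actionOld S) (oldLetter hbar S l f) χ' := by
  cases l with
  | xe i =>
    exact exists_isLift_mul ((ContinuousLinearMap.proj i).comp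
      ((ContinuousLinearMap.fst ℝ (e → ℝ) (b → ℝ)).comp
        ((ContinuousLinearMap.snd ℝ (β → ℝ) (CfgNew e b)).comp
          (ContinuousLinearMap.snd ℝ (α → ℝ) ((β → ℝ) × CfgNew e b))))) h
  | xb i =>
    exact exists_isLift_mul ((ContinuousLinearMap.proj i).comp
      ((ContinuousLinearMap.snd ℝ (e → ℝ) (b → ℝ)).comp
        ((ContinuousLinearMap.snd ℝ (β → ℝ) (CfgNew e b)).comp
          (ContinuousLinearMap.snd ℝ (α → ℝ) ((β → ℝ) × CfgNew e b))))) h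
  | pOld i => exact ⟨_, isLift_shiftedMomentum hb hS h _⟩
  | pe i => exact ⟨_, isLift_shiftedMomentum hb hS h _⟩
  | pb i => exact ⟨_, isLift_shiftedMomentum hb hS h _⟩

lemma integrateOld_shiftedMomentum_old (hb : hbar ≠ 0) (hS : ContDiff ℝ ∞ S)
    {f : CfgOld α β e b → ℂ} {χ : 𝓢(CfgOld α β e b, ℂ)} (h : IsLift hbar (actionOld S) f χ)
    (o : α ⊕ β) :
    integrateOld hbar S (shiftedMomentum hbar (actionOld S) (oldDir o) f) = fun _ => 0 := by
  rw [integrateOld_eq_marginal (isLift_shiftedMomentum hb hS h _)]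
  funext y
  rw [marginal_smul]
  cases o with
  | inl i => exact mul_eq_zero_of_right _ (marginal_lineDerivOp_old χ (Pi.single i 1, 0) y)
  | inr i => exact mul_eq_zero_of_right _ (marginal_lineDerivOp_old χ (0, Pi.single i 1) y)

lemma integrateOld_shiftedMomentum_new (hb : hbar ≠ 0) (hS : ContDiff ℝ ∞ S)
    {f : CfgOld α β e b → ℂ} {χ : 𝓢(CfgOld α β e b, ℂ)} (h : IsLift hbar (actionOld S) f χ)
    (v : CfgNew e b) :
    integrateOld hbar S (shiftedMomentum hbar (actionOld S) (0, 0, v) f) =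
      shiftedMomentum hbar (fun _ => 0) v (integrateOld hbar S f) := by
  rw [integrateOld_eq_marginal (isLift_shiftedMomentum hb hS h _), integrateOld_eq_marginal h]
  funext y
  rw [marginal_smul, shiftedMomentum, (hasLineDerivAt_marginal χ y v).lineDeriv]
  simp [lineDeriv]

/-- Momentum updating for the canonical variables. -/
lemma integrateOld_oldLetter (hb : hbar ≠ 0) (hS : ContDiff ℝ ∞ S) (l : Letter α β e b)
    {f : CfgOld α β e b → ℂ} {χ : 𝓢(CfgOld α β e b, ℂ)} (h : IsLift hbar (actionOld S) f χ) :
    integrateOld hbar S (oldLetter hbar S l f) = newLetter hbar l (integrateOld hbar S f) := by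
  cases l with
  | xe i =>
    funext y
    simp only [oldLetter, newLetter, integrateOld, ← integral_const_mul]
    exact integral_congr_ae (Eventually.of_forall fun q => mul_left_comm _ _ _)
  | xb i =>
    funext y
    simp only [oldLetter, newLetter, integrateOld, ← integral_const_mul]
    exact integral_congr_ae (Eventually.of_forall fun q => mul_left_comm _ _ _)
  | pOld i => exact integrateOld_shiftedMomentum_old hb hS h i
  | pe i => exact integrateOld_shiftedMomentum_new hb hS h _
  | pb i => exact integrateOld_shiftedMomentum_new hb hS h _

/-- After multiplication by the phase, the flow is a translation and the momentum a
constant-coefficient derivative, and these commute. -/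
lemma shiftedMomentum_preFlow (hb : hbar ≠ 0) (hS : ContDiff ℝ ∞ S)
    {f : CfgOld α β e b → ℂ} {χ : 𝓢(CfgOld α β e b, ℂ)} (h : IsLift hbar (actionOld S) f χ)
    (t : (α → ℝ) × (β → ℝ)) (v : CfgOld α β e b) :
    shiftedMomentum hbar (actionOld S) v (preFlow hbar S t f) =
      preFlow hbar S t (shiftedMomentum hbar (actionOld S) v f) := by
  refine phase_mul_injective (hbar := hbar) (S := actionOld S) fun x => ?_
  have hd : Differentiable ℝ fun x : CfgOld α β e b => χ (x + (t.1, t.2, 0)) :=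
    χ.differentiable.comp (differentiable_id.add_const _)
  rw [phase_mul_preFlow, phase_mul_shiftedMomentum hb (differentiable_actionOld hS) hd
    fun x => by rw [phase_mul_preFlow, h],
    phase_mul_shiftedMomentum hb (differentiable_actionOld hS) χ.differentiable h]
  congr 1
  simp only [lineDeriv, add_right_comm]

/-- The canonical variables commute with the unitary group of the pre-constraints. -/
lemma oldLetter_preFlow (hb : hbar ≠ 0) (hS : ContDiff ℝ ∞ S) (l : Letter α β e b)
    {f : CfgOld α β e b → ℂ} {χ : 𝓢(CfgOld α β e b, ℂ)} (h : IsLift hbar (actionOld S) f χ)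
    (t : (α → ℝ) × (β → ℝ)) :
    oldLetter hbar S l (preFlow hbar S t f) = preFlow hbar S t (oldLetter hbar S l f) := by
  cases l with
  | xe i =>
    funext x
    simp only [oldLetter, preFlow]
    ring
  | xb i =>
    funext x
    simp only [oldLetter, preFlow]
    ring
  | pOld i => exact shiftedMomentum_preFlow hb hS h t _
  | pe i => exact shiftedMomentum_preFlow hb hS h t _
  | pb i => exact shiftedMomentum_preFlow hb hS h t _

lemma exists_isLift_wordOp (hb : hbar ≠ 0) (hS : ContDiff ℝ ∞ S) (w : List (Letter α β e b))
    {f : CfgOld α β e b → ℂ} {χ : 𝓢(CfgOld α β e b, ℂ)} (h : IsLift hbar (actionOld S) f χ) :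
    ∃ χ', IsLift hbar (actionOld S) (wordOp (oldLetter hbar S) w f) χ' := by
  induction w with
  | nil => exact ⟨χ, h⟩
  | cons l w ih =>
    obtain ⟨χ', h'⟩ := ih
    exact exists_isLift_oldLetter hb hS l h'

lemma integrateOld_wordOp (hb : hbar ≠ 0) (hS : ContDiff ℝ ∞ S) (w : List (Letter α β e b))
    {f : CfgOld α β e b → ℂ} {χ : 𝓢(CfgOld α β e b, ℂ)} (h : IsLift hbar (actionOld S) f χ) :
    integrateOld hbar S (wordOp (oldLetter hbar S) w f) =
      wordOp (newLetter hbar) w (integrateOld hbar S f) := by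
  induction w with
  | nil => rfl
  | cons l w ih =>
    obtain ⟨χ', h'⟩ := exists_isLift_wordOp hb hS w h
    rw [wordOp, wordOp, integrateOld_oldLetter hb hS l h', ih]

lemma wordOp_preFlow (hb : hbar ≠ 0) (hS : ContDiff ℝ ∞ S) (w : List (Letter α β e b))
    {f : CfgOld α β e b → ℂ} {χ : 𝓢(CfgOld α β e b, ℂ)} (h : IsLift hbar (actionOld S) f χ)
    (t : (α → ℝ) × (β → ℝ)) :
    wordOp (oldLetter hbar S) w (preFlow hbar S t f) =
      preFlow hbar S t (wordOp (oldLetter hbar S) w f) := by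
  induction w with
  | nil => rfl
  | cons l w ih =>
    obtain ⟨χ', h'⟩ := exists_isLift_wordOp hb hS w h
    rw [wordOp, wordOp, ih, oldLetter_preFlow hb hS l h']

/-- Momentum updating for convergent power series. -/
lemma newConstraint_integrateOld (hb : hbar ≠ 0) (hS : ContDiff ℝ ∞ S)
    {d : List (Letter α β e b) → ℂ} {f : CfgOld α β e b → ℂ} {χ : 𝓢(CfgOld α β e b, ℂ)}
    (h : IsLift hbar (actionOld S) f χ)
    (hd : TestHasSum hbar (actionOld S) (fun w x => d w * wordOp (oldLetter hbar S) w f x)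
      (oldConstraint hbar S d f)) :
    newConstraint hbar d (integrateOld hbar S f) = integrateOld hbar S (oldConstraint hbar S d f) := by
  obtain ⟨X, η, h1, h2, h3⟩ := hd
  funext y
  -- Integration over `x^o` at a fixed point is a continuous functional on Schwartz space, so it
  -- passes through the series termwise.
  have hs := h3.mapL (marginalEval y)
  simp only [marginalEval_apply] at hs
  rw [integrateOld_eq_marginal h2, ← hs.tsum_eq, newConstraint, seriesOp]
  refine tsum_congr fun w => ?_
  rw [← integrateOld_wordOp hb hS w h, ← integrateOld_eq_marginal (h1 w), integrateOld,
    integrateOld, ← integral_const_mul]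
  exact integral_congr_ae (Eventually.of_forall fun q => mul_left_comm _ _ _)

/-- No convergence is involved: the flow is a shift of the argument followed by multiplication by a
scalar, and `tsum_mul_left` holds unconditionally in a field. -/
lemma oldConstraint_preFlow (hb : hbar ≠ 0) (hS : ContDiff ℝ ∞ S)
    (d : List (Letter α β e b) → ℂ) {f : CfgOld α β e b → ℂ} {χ : 𝓢(CfgOld α β e b, ℂ)}
    (h : IsLift hbar (actionOld S) f χ) (t : (α → ℝ) × (β → ℝ)) :
    oldConstraint hbar S d (preFlow hbar S t f) = preFlow hbar S t (oldConstraint hbar S d f) := by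
  funext x
  simp only [oldConstraint, seriesOp, wordOp_preFlow hb hS _ h, preFlow, ← tsum_mul_left]
  exact tsum_congr fun w => by ring

/-- A curve of Schwartz functions with velocity `∂_v` consists of translates. -/
lemma eq_translate_of_hasDerivAt {Z : Type*} [NormedAddCommGroup Z] [NormedSpace ℝ Z]
    (X : ℝ → 𝓢(Z, ℂ)) (v : Z)
    (h : ∀ t, HasDerivAt (fun t => SchwartzMap.toBoundedContinuousFunctionCLM ℂ Z ℂ (X t))
      (SchwartzMap.toBoundedContinuousFunctionCLM ℂ Z ℂ (LineDeriv.lineDerivOp v (X t))) t)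
    (t : ℝ) (z : Z) : X t z = X 0 (z + t • v) := by
  -- Method of characteristics: this function takes the two values to be compared at `τ = t` and `τ
  -- = 0`.
  have hd : ∀ τ, HasDerivAt (fun τ => X τ (z + (t - τ) • v)) 0 τ := by
    intro τ
    have h1 := hasDerivAt_iff_tendsto_slope_zero.1 (h τ)
    have h2 : Tendsto (fun s : ℝ => z + (t - (τ + s)) • v) (𝓝[≠] 0) (𝓝 (z + (t - τ) • v)) := by
      have : Continuous fun s : ℝ => z + (t - (τ + s)) • v := by fun_prop
      simpa using (this.tendsto 0).mono_left nhdsWithin_le_nhds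
    -- The difference quotients converge uniformly, so they may be evaluated at a moving point.
    have h3 := (continuous_eval.tendsto
      (SchwartzMap.toBoundedContinuousFunctionCLM ℂ Z ℂ (LineDeriv.lineDerivOp v (X τ)),
        z + (t - τ) • v)).comp (h1.prodMk_nhds h2)
    have h4 := (hasDerivAt_schwartz (X τ) z v (t - τ)).scomp τ
      ((hasDerivAt_const τ t).sub (hasDerivAt_id τ))
    have h5 := h3.add (hasDerivAt_iff_tendsto_slope_zero.1 h4)
    rw [hasDerivAt_iff_tendsto_slope_zero]
    convert h5 using 2 with s
    · simp [smul_sub]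
    · simp
  have := is_const_of_deriv_eq_zero (fun τ => (hd τ).differentiableAt) (fun τ => (hd τ).deriv) t 0
  simpa using this

end TypeII

/-! ### Intertwining of the unitary groups at steps `k` and `k+1`. -/

section TypeII

variable {α β e b : Type} [Fintype α] [DecidableEq α] [Fintype β] [DecidableEq β]
  [Fintype e] [DecidableEq e] [Fintype b] [DecidableEq b]
  {hbar : ℝ} {S : (α → ℝ) × (β → ℝ) × (e → ℝ) → ℝ} {ι : Type} [Fintype ι] [DecidableEq ι]
  {c : ι → List (Letter α β e b) → ℂ}

/-- On lifts `Ĉ_α` is `-iħ ∂_α` and `(i/ħ)(-iħ) = 1`, so the orbit solves the transport equation of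
`eq_translate_of_hasDerivAt`. -/
lemma lift_V_inl (hS : ContDiff ℝ ∞ S)
    (Q : ConstraintSystem hbar (actionOld (b := b) S) (postConstraint hbar S c))
    (i : α) (t : ℝ) (f : Q.Φ) (x : CfgOld α β e b) :
    Q.lift (Q.V (Pi.single (Sum.inl i) t) f) x = Q.lift f (x + t • oldDir (Sum.inl i)) := by
  have hb : (hbar : ℂ) ≠ 0 := Complex.ofReal_ne_zero.2 Q.hbar_pos.ne'
  have h : ∀ g : Q.Φ, (Complex.I / (hbar : ℂ)) • Q.lift (Q.op (Sum.inl i) g) =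
      LineDeriv.lineDerivOp (oldDir (Sum.inl i) : CfgOld α β e b) (Q.lift g) := by
    intro g
    have hl : IsLift hbar (actionOld S) (Q.op (Sum.inl i) g : CfgOld α β e b → ℂ) _ :=
      isLift_shiftedMomentum Q.hbar_pos.ne' hS (Q.lift_apply g) (oldDir (Sum.inl i))
    rw [← Q.lift_eq _ hl, smul_smul]
    have : Complex.I / (hbar : ℂ) * -(Complex.I * hbar) = 1 := by
      field_simp
      rw [Complex.I_sq, neg_neg]
    rw [this, one_smul]
  have := eq_translate_of_hasDerivAt (fun t => Q.lift (Q.V (Pi.single (Sum.inl i) t) f))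
    (oldDir (Sum.inl i)) (fun t => by
      have := Q.hasDerivAt_V (SchwartzMap.toBoundedContinuousFunctionCLM ℂ _ ℂ) (Sum.inl i) f t
      rwa [← map_smul, h] at this) t x
  rwa [Pi.single_zero, Q.V_zero] at this

/-- The post-constraints `Ĉ_α` generate translations of `x^α`. -/
lemma lift_V_alpha (hS : ContDiff ℝ ∞ S)
    (Q : ConstraintSystem hbar (actionOld (b := b) S) (postConstraint hbar S c))
    (a : α → ℝ) (f : Q.Φ) (x : CfgOld α β e b) :
    Q.lift (Q.V (Sum.elim a 0) f) x = Q.lift f (x + (a, 0, 0)) := by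
  have key : ∀ F : Finset α, ∀ x : CfgOld α β e b,
      Q.lift (Q.V (∑ i ∈ F, Pi.single (Sum.inl i) (a i)) f) x =
        Q.lift f (x + ∑ i ∈ F, a i • oldDir (Sum.inl i)) := by
    intro F
    induction F using Finset.induction_on with
    | empty => intro x; simp [Q.V_zero]
    | insert i F hi ih =>
      intro x
      rw [Finset.sum_insert hi, Finset.sum_insert hi, Q.V_add, lift_V_inl hS, ih, add_assoc]
  have h1 : (Sum.elim a 0 : α ⊕ ι → ℝ) = ∑ i, Pi.single (Sum.inl i) (a i) := by
    funext j
    rw [Finset.sum_apply]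
    cases j with
    | inl j => simp [Pi.single_apply]
    | inr j => simp
  have h2 : ((a, 0, 0) : CfgOld α β e b) = ∑ i, a i • oldDir (Sum.inl i) := by
    refine Prod.ext ?_ ?_
    · rw [Prod.fst_sum]
      funext j
      simp [oldDir, Pi.single_apply]
    · rw [Prod.snd_sum]
      simp [oldDir, Prod.ext_iff]
  rw [h1, h2, key]

section Move

variable {Q : ConstraintSystem hbar (actionOld (b := b) S) (postConstraint hbar S c)}
  {Q₁ : ConstraintSystem hbar (fun _ : CfgNew e b => (0 : ℝ)) fun j => newConstraint hbar (c j)}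

lemma integrateOld_eq_marginal_lift (f : Q.Φ) :
    integrateOld hbar S (f : CfgOld α β e b → ℂ) = marginal (Q.lift f) :=
  integrateOld_eq_marginal (Q.lift_apply f)

/-- The map `f ↦ ∫ dx^o e^{i S / ħ} f` between the test states. -/
def MoveDomain.integrate (hQ : MoveDomain Q Q₁) : Q.Φ →ₗ[ℂ] Q₁.Φ where
  toFun f := ⟨integrateOld hbar S f, (hQ.mem_new _).2 ⟨f, f.2, rfl⟩⟩
  map_add' f g := by
    refine Subtype.ext (funext fun y => ?_)
    simp only [Submodule.coe_add, Pi.add_apply]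
    rw [← Submodule.coe_add, integrateOld_eq_marginal_lift, integrateOld_eq_marginal_lift,
      integrateOld_eq_marginal_lift, map_add, marginal_add]
  map_smul' a f := by
    refine Subtype.ext (funext fun y => ?_)
    simp only [RingHom.id_apply, Submodule.coe_smul, Pi.smul_apply, smul_eq_mul]
    rw [← Submodule.coe_smul, integrateOld_eq_marginal_lift, integrateOld_eq_marginal_lift,
      map_smul, marginal_smul]

lemma MoveDomain.coe_integrate (hQ : MoveDomain Q Q₁) (f : Q.Φ) :
    (hQ.integrate f : CfgNew e b → ℂ) = marginal (Q.lift f) := integrateOld_eq_marginal_lift f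

lemma MoveDomain.integrate_surjective (hQ : MoveDomain Q Q₁) :
    Function.Surjective hQ.integrate := fun h => by
  obtain ⟨f, hf, h'⟩ := (hQ.mem_new h).1 h.2
  exact ⟨⟨f, hf⟩, Subtype.ext h'.symm⟩

/-- The phase at `k+1` is 1. Through this identity a Schwartz derivative of an orbit at `k` becomes
an `L²` derivative of its image at `k+1`. -/
lemma MoveDomain.marginalLp_lift (hQ : MoveDomain Q Q₁) (f : Q.Φ) :
    marginalLp (Q.lift f) =
      SchwartzMap.toLpCLM ℂ ℂ 2 volume (Q₁.lift (hQ.integrate f)) := by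
  have h : marginal (Q.lift f) = Q₁.lift (hQ.integrate f) := by
    funext y
    rw [Q₁.lift_apply, phase_zero, one_mul, hQ.coe_integrate]
  exact MemLp.toLp_congr (memLp_marginal _) (SchwartzMap.memLp _ 2 volume)
    (Eventually.of_forall fun y => congrFun h y)

/-- Momentum updating of the post-constraints. -/
lemma MoveDomain.integrate_op (hS : ContDiff ℝ ∞ S) (hc : ∀ j, SeriesOn hbar S Q.Φ (c j))
    (hQ : MoveDomain Q Q₁) (j : ι) (f : Q.Φ) :
    hQ.integrate (Q.op (Sum.inr j) f) = Q₁.op j (hQ.integrate f) :=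
  Subtype.ext (newConstraint_integrateOld Q.hbar_pos.ne' hS (Q.lift_apply f) (hc j f f.2).2).symm

/-- The image of an orbit at `k` satisfies in `L²` the Schrödinger equation of the updated
constraint, and `eq_V_of_hasDerivAt` identifies its solutions. -/
lemma MoveDomain.integrate_V_inr (hS : ContDiff ℝ ∞ S) (hc : ∀ j, SeriesOn hbar S Q.Φ (c j))
    (hQ : MoveDomain Q Q₁) (j : ι) (t : ℝ) (f : Q.Φ) :
    hQ.integrate (Q.V (Pi.single (Sum.inr j) t) f) = Q₁.V (Pi.single j t) (hQ.integrate f) := by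
  have := Q₁.eq_V_of_hasDerivAt j (fun t => hQ.integrate (Q.V (Pi.single (Sum.inr j) t) f))
    (fun t => by
      have := Q.hasDerivAt_V marginalLp (Sum.inr j) f t
      simp only [hQ.marginalLp_lift, hQ.integrate_op hS hc] at this
      exact this) t
  simpa only [Pi.single_zero, Q.V_zero] using this

/-- The integration over the old variables intertwines the unitary groups. -/
lemma MoveDomain.integrate_V (hS : ContDiff ℝ ∞ S) (hc : ∀ j, SeriesOn hbar S Q.Φ (c j))
    (hQ : MoveDomain Q Q₁) (σ : ι → ℝ) (f : Q.Φ) :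
    hQ.integrate (Q.V (Sum.elim 0 σ) f) = Q₁.V σ (hQ.integrate f) := by
  have key : ∀ F : Finset ι, hQ.integrate (Q.V (∑ j ∈ F, Pi.single (Sum.inr j) (σ j)) f) =
      Q₁.V (∑ j ∈ F, Pi.single j (σ j)) (hQ.integrate f) := by
    intro F
    induction F using Finset.induction_on with
    | empty => simp [Q.V_zero, Q₁.V_zero]
    | insert j F hj ih =>
      rw [Finset.sum_insert hj, Finset.sum_insert hj, Q.V_add, Q₁.V_add,
        hQ.integrate_V_inr hS hc, ih]
  have h1 : (Sum.elim 0 σ : α ⊕ ι → ℝ) = ∑ j, Pi.single (Sum.inr j) (σ j) := by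
    funext j
    rw [Finset.sum_apply]
    cases j with
    | inl j => simp
    | inr j => simp [Pi.single_apply]
  rw [h1, key, Finset.univ_sum_single]

end Move

end TypeII

/-! ### State updating and `ℙ^B` in terms of the improper projector at step `k+1`. -/

/-- The arrangement `(σ, (a, x)) ↦ ((a, σ), x)` of group parameters and variables. -/
def sumElimEquiv (α β ι : Type) :
    (ι → ℝ) × ((α → ℝ) × (β → ℝ)) ≃ᵐ (α ⊕ ι → ℝ) × (β → ℝ) :=
  MeasurableEquiv.prodAssoc.symm.trans
    ((MeasurableEquiv.prodComm.trans
      (MeasurableEquiv.sumPiEquivProdPi fun _ : α ⊕ ι => ℝ).symm).prodCongr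
        (MeasurableEquiv.refl (β → ℝ)))

lemma sumElimEquiv_apply {α β ι : Type} (σ : ι → ℝ) (a : α → ℝ) (x : β → ℝ) :
    sumElimEquiv α β ι (σ, (a, x)) = (Sum.elim a σ, x) := by
  refine Prod.ext (funext fun j => ?_) rfl
  cases j <;> rfl

lemma measurePreserving_sumElimEquiv (α β ι : Type) [Fintype α] [Fintype β] [Fintype ι] :
    MeasurePreserving (sumElimEquiv α β ι) volume volume := by
  have h1 : MeasurePreserving (Prod.swap : (ι → ℝ) × (α → ℝ) → (α → ℝ) × (ι → ℝ))
    volume volume := Measure.measurePreserving_swap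
  exact (((volume_measurePreserving_sumPiEquivProdPi_symm fun _ : α ⊕ ι => ℝ).comp h1).prod
    (MeasurePreserving.id (volume : Measure (β → ℝ)))).comp
      (volume_preserving_prodAssoc (α₁ := ι → ℝ) (β₁ := α → ℝ) (γ₁ := β → ℝ)).symm

section TypeII

variable {α β e b : Type} [Fintype α] [DecidableEq α] [Fintype β] [DecidableEq β]
  [Fintype e] [DecidableEq e] [Fintype b] [DecidableEq b]
  {hbar : ℝ} {S : (α → ℝ) × (β → ℝ) × (e → ℝ) → ℝ} {ι : Type} [Fintype ι] [DecidableEq ι]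
  {c : ι → List (Letter α β e b) → ℂ}
  {Q : ConstraintSystem hbar (actionOld (b := b) S) (postConstraint hbar S c)}
  {Q₁ : ConstraintSystem hbar (fun _ : CfgNew e b => (0 : ℝ)) fun j => newConstraint hbar (c j)}

lemma planck_ne_zero (hb : 0 < hbar) : ((2 * Real.pi * hbar : ℝ) : ℂ) ≠ 0 :=
  Complex.ofReal_ne_zero.2 (mul_pos Real.two_pi_pos hb).ne'

lemma integrable_phase_mul {X : Type*} [TopologicalSpace X] [MeasurableSpace X]
    [OpensMeasurableSpace X] {μ : Measure X} {Z : Type} {T : Z → ℝ} {k : X → Z}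
    (hk : Continuous fun x => T (k x)) {g : X → ℂ} (hg : Integrable g μ) :
    Integrable (fun x => phase hbar T (k x) * g x) μ := by
  refine hg.bdd_mul (c := 1) (Continuous.aestronglyMeasurable ?_)
    (Eventually.of_forall fun x => (ConstraintSystem.norm_phase _ _ _).le)
  exact Complex.continuous_exp.comp (continuous_const.mul
    (Complex.continuous_ofReal.comp (hk.div_const hbar)))

/-- The integral of a group average over the old variables `x^β`, at fixed `x^α`. -/
lemma MoveDomain.integral_phase_mul_avg (hS : ContDiff ℝ ∞ S)
    (hc : ∀ j, SeriesOn hbar S Q.Φ (c j)) (hQ : MoveDomain Q Q₁) (f : Q.Φ) (xα : α → ℝ)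
    (y : CfgNew e b) :
    ((2 * Real.pi * hbar : ℝ) : ℂ) ^ Fintype.card α *
      ∫ xβ : β → ℝ, phase hbar (actionOld S) (xα, xβ, y) * Q.avg f (xα, xβ, y) =
        Q₁.avg (hQ.integrate f) y := by
  set g : (α ⊕ ι → ℝ) × (β → ℝ) → ℂ := fun p => Q.lift (Q.V p.1 f) (xα, p.2, y) with hg
  have hgi : Integrable g := by
    have h := integrable_phase_mul (hbar := hbar) (T := actionOld S)
      (k := fun p : (α ⊕ ι → ℝ) × (β → ℝ) => ((xα, p.2, y) : CfgOld α β e b))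
      (Q.continuous_action.comp (by fun_prop)) (hQ.integrable_update f xα y)
    simpa only [hg, Q.lift_apply] using h
  have hr := measurePreserving_sumElimEquiv α β ι
  -- Factoring the group element, its `α`-part becomes a translation of `x^α`. The pair of group
  -- parameter `a` and variable `x^β` thus plays the role of the full `x^o`, shifted by the fixed
  -- `x^α`, which translation invariance removes.
  have hcomp : ∀ σ (q : (α → ℝ) × (β → ℝ)), g (sumElimEquiv α β ι (σ, q)) =
      Q.lift (Q.V (Sum.elim 0 σ) f) (((xα, 0) + q).1, ((xα, 0) + q).2, y) := by
    intro σ q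
    have hsum : (Sum.elim q.1 σ : α ⊕ ι → ℝ) = Sum.elim q.1 0 + (Sum.elim 0 σ : α ⊕ ι → ℝ) := by
      funext j
      cases j <;> simp
    rw [sumElimEquiv_apply, hg]
    simp only
    rw [hsum, Q.V_add, lift_V_alpha hS]
    simp
  have h1 : ∫ xβ : β → ℝ, phase hbar (actionOld S) (xα, xβ, y) * Q.avg f (xα, xβ, y) =
      (((2 * Real.pi * hbar : ℝ) : ℂ) ^ Fintype.card (α ⊕ ι))⁻¹ * ∫ p, g p := by
    rw [Measure.volume_eq_prod, integral_prod_symm g hgi, ← integral_const_mul]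
    refine integral_congr_ae (Eventually.of_forall fun xβ => ?_)
    simp only [hg, Q.lift_apply, ConstraintSystem.avg, LinearMap.coe_mk, AddHom.coe_mk]
    rw [integral_const_mul, mul_left_comm]
  have h2 : ∫ p, g p = ∫ σ : ι → ℝ, (Q₁.V σ (hQ.integrate f) : CfgNew e b → ℂ) y := by
    have hi := (hr.integrable_comp_emb (sumElimEquiv α β ι).measurableEmbedding).2 hgi
    refine (hr.integral_comp (sumElimEquiv α β ι).measurableEmbedding g).symm.trans
      ((integral_prod _ hi).trans ?_)
    refine integral_congr_ae (Eventually.of_forall fun σ => ?_)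
    simp only [Function.comp_apply, hcomp]
    rw [integral_add_left_eq_self (μ := volume)
      (fun q : (α → ℝ) × (β → ℝ) => Q.lift (Q.V (Sum.elim 0 σ) f) (q.1, q.2, y)) (xα, 0),
      ← hQ.integrate_V hS hc, hQ.coe_integrate, marginal]
  rw [h1, h2, Fintype.card_sum, pow_add]
  simp only [ConstraintSystem.avg, LinearMap.coe_mk, AddHom.coe_mk]
  have := pow_ne_zero (Fintype.card α) (planck_ne_zero Q.hbar_pos)
  rw [mul_inv, ← mul_assoc, ← mul_assoc, mul_inv_cancel₀ this, one_mul]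

/-- State updating of a group average. -/
lemma MoveDomain.update_avg (hS : ContDiff ℝ ∞ S)
    (hc : ∀ j, SeriesOn hbar S Q.Φ (c j)) (hQ : MoveDomain Q Q₁) (M : ℂ) (x' : α → ℝ) (f : Q.Φ) :
    update hbar S M x' (Q.avg f) = M • Q₁.avg (hQ.integrate f) := by
  funext y
  -- The Dirac factor evaluates at `x^α = x'`; the preceding lemma gives the same value at every
  -- `x^α`.
  rw [Pi.smul_apply, smul_eq_mul, ← hQ.integral_phase_mul_avg hS hc f x' y, update,
    Measure.dirac_prod, (measurableEmbedding_prodMk_left x').integral_map, mul_left_comm,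
    ← integral_const_mul M]
  simp only [mul_assoc]

/-- The flow parameter of `ℙ^B` translates `x^β`, so averaging over it is the full `x^β`-integral of
`integral_phase_mul_avg`. Up to the phase, `ℙ^B ℙ g` therefore depends on the kept variables only.
-/
lemma MoveDomain.phase_mul_projB_avg (hS : ContDiff ℝ ∞ S)
    (hc : ∀ j, SeriesOn hbar S Q.Φ (c j)) (hQ : MoveDomain Q Q₁) (g : Q.Φ)
    (x : CfgOld α β e b) :
    phase hbar (actionOld S) x * projB hbar S (Q.avg g) x =
      (((2 * Real.pi * hbar : ℝ) : ℂ) ^ (Fintype.card α + Fintype.card β))⁻¹ *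
        Q₁.avg (hQ.integrate g) x.2.2 := by
  rw [← hQ.integral_phase_mul_avg hS hc g x.1, projB, mul_left_comm, ← integral_const_mul]
  simp only [phase_mul_preFlow]
  have h := integral_add_left_eq_self (μ := (volume : Measure (β → ℝ)))
    (fun t => phase hbar (actionOld S) (x.1, t, x.2.2) * Q.avg g (x.1, t, x.2.2)) x.2.1
  have hx : ∀ t : β → ℝ, x + ((0, t, 0) : CfgOld α β e b) = (x.1, x.2.1 + t, x.2.2) := by
    intro t
    simp [Prod.ext_iff]
  simp only [hx]
  rw [h, pow_add, mul_inv]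
  have := pow_ne_zero (Fintype.card α) (planck_ne_zero Q.hbar_pos)
  field_simp

/-- The matrix elements of `ℙ^B` are those of the improper projector at step `k + 1`. -/
lemma MoveDomain.l2_projB (hS : ContDiff ℝ ∞ S)
    (hc : ∀ j, SeriesOn hbar S Q.Φ (c j)) (hQ : MoveDomain Q Q₁) (f g : Q.Φ) :
    l2 (hQ.integrate f : CfgNew e b → ℂ) (Q₁.avg (hQ.integrate g)) =
      ((2 * Real.pi * hbar : ℝ) : ℂ) ^ (Fintype.card α + Fintype.card β) *
        l2 (f : CfgOld α β e b → ℂ) (projB hbar S (Q.avg g)) := by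
  set H := Q₁.avg (hQ.integrate g) with hH
  have hne := pow_ne_zero (Fintype.card α + Fintype.card β) (planck_ne_zero Q.hbar_pos)
  have hpt : ∀ x, conj (Q.lift f x) * H x.2.2 =
      ((2 * Real.pi * hbar : ℝ) : ℂ) ^ (Fintype.card α + Fintype.card β) *
        (conj ((f : CfgOld α β e b → ℂ) x) * projB hbar S (Q.avg g) x) := by
    intro x
    have h := hQ.phase_mul_projB_avg hS hc g x
    rw [eq_inv_mul_iff_mul_eq₀ hne] at h
    rw [hH, ← h, Q.lift_apply, map_mul]
    linear_combination (((2 * Real.pi * hbar : ℝ) : ℂ) ^ (Fintype.card α + Fintype.card β) *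
      conj ((f : CfgOld α β e b → ℂ) x) * projB hbar S (Q.avg g) x) *
        conj_phase_mul_phase hbar (actionOld S) x
  have hi : Integrable fun x : CfgOld α β e b => conj (Q.lift f x) * H x.2.2 := by
    simp only [hpt]
    refine Integrable.const_mul ?_ _
    have := (hQ.integrable_projB f (Q.proj g)).integral_prod_right.const_mul
      (((2 * Real.pi * hbar : ℝ) : ℂ) ^ Fintype.card β)⁻¹
    refine this.congr (Eventually.of_forall fun x => ?_)
    simp only [projB, Q.wave_proj]
    rw [integral_const_mul]
    ring
  have hr := volume_preserving_prodAssoc (α₁ := α → ℝ) (β₁ := β → ℝ) (γ₁ := CfgNew e b)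
  have hi' := (hr.integrable_comp_emb MeasurableEquiv.prodAssoc.measurableEmbedding).2 hi
  -- As `H` does not depend on `x^o`, integrating over `x^o` first produces the marginal of the lift
  -- of `f`.
  have h1 : ∫ x : CfgOld α β e b, conj (Q.lift f x) * H x.2.2 =
      l2 (hQ.integrate f : CfgNew e b → ℂ) H := by
    refine (hr.integral_comp MeasurableEquiv.prodAssoc.measurableEmbedding _).symm.trans
      ((integral_prod_symm _ hi').trans ?_)
    refine integral_congr_ae (Eventually.of_forall fun y => ?_)
    simp only
    rw [hQ.coe_integrate, marginal, ← integral_conj, ← integral_mul_const]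
    rfl
  rw [← h1, l2, ← integral_const_mul]
  simp only [hpt]

/-- `ℙ^B` as an average over the unitary group acting on the test states. -/
lemma MoveDomain.l2_projB_wave (hQ : MoveDomain Q Q₁) (f : Q.Φ) (ψ : Q.PhysState) :
    l2 (f : CfgOld α β e b → ℂ) (projB hbar S (Q.wave ψ)) =
      (((2 * Real.pi * hbar : ℝ) : ℂ) ^ Fintype.card β)⁻¹ *
        ∫ t : β → ℝ, l2 (preFlow hbar S (0, -t) f) (Q.wave ψ) := by
  have h1 : ∀ t : β → ℝ, l2 (preFlow hbar S (0, -t) f) (Q.wave ψ) =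
      ∫ x, conj ((f : CfgOld α β e b → ℂ) x) * preFlow hbar S (0, t) (Q.wave ψ) x := by
    intro t
    -- Substituting the translate moves the flow from the test state to `ψ`; the remaining phases
    -- have modulus one.
    rw [l2, ← integral_add_right_eq_self (μ := volume) _ ((0, t, 0) : CfgOld α β e b)]
    refine integral_congr_ae (Eventually.of_forall fun x => ?_)
    simp only
    have ha := phase_mul_preFlow (hbar := hbar) (S := S) (0, -t) (f : CfgOld α β e b → ℂ)
      (x + (0, t, 0))
    have hb := phase_mul_preFlow (hbar := hbar) (S := S) (0, t) (Q.wave ψ) x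
    have hx : x + ((0, t, 0) : CfgOld α β e b) + (0, -t, 0) = x := by simp [Prod.ext_iff]
    simp only [hx] at ha
    replace ha := congrArg conj ha
    rw [map_mul, map_mul] at ha
    have hp := conj_phase_mul_phase hbar (actionOld S) (x + ((0, t, 0) : CfgOld α β e b))
    have hq := conj_phase_mul_phase hbar (actionOld S) x
    set A := phase hbar (actionOld S) (x + ((0, t, 0) : CfgOld α β e b))
    set B := phase hbar (actionOld S) x
    linear_combination (-(conj (preFlow hbar S (0, -t) f (x + (0, t, 0))) *
      Q.wave ψ (x + (0, t, 0)))) * hp + A * Q.wave ψ (x + (0, t, 0)) * ha +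
      (conj ((f : CfgOld α β e b → ℂ) x) * preFlow hbar S (0, t) (Q.wave ψ) x) * hq -
      conj B * conj ((f : CfgOld α β e b → ℂ) x) * hb
  simp only [h1]
  rw [integral_integral_swap
    (f := fun t x => conj ((f : CfgOld α β e b → ℂ) x) * preFlow hbar S (0, t) (Q.wave ψ) x)
    (hQ.integrable_projB f ψ), l2, ← integral_const_mul]
  refine integral_congr_ae (Eventually.of_forall fun x => ?_)
  simp only [projB]
  rw [integral_const_mul, mul_left_comm]

/-- The parameter space `β → ℝ` is a single point of mass 1, and the normalization is a zeroth
power. -/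
lemma projB_of_isEmpty [IsEmpty β] (ψ : CfgOld α β e b → ℂ) : projB hbar S ψ = ψ := by
  refine phase_mul_injective (hbar := hbar) (S := actionOld S) fun x => ?_
  have hx : ∀ t : β → ℝ, x + ((0, t, 0) : CfgOld α β e b) = x := fun t => by
    rw [Subsingleton.elim t 0]
    exact add_zero x
  rw [projB, mul_left_comm, ← integral_const_mul]
  simp only [phase_mul_preFlow, hx]
  simp [Measure.real, volume_pi]

end TypeII

/-! ### The updating map on physical states and its properties. -/

section TypeII

variable {α β e b : Type} [Fintype α] [DecidableEq α] [Fintype β] [DecidableEq β]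
  [Fintype e] [DecidableEq e] [Fintype b] [DecidableEq b]
  {hbar : ℝ} {S : (α → ℝ) × (β → ℝ) × (e → ℝ) → ℝ} {ι : Type} [Fintype ι] [DecidableEq ι]
  {c : ι → List (Letter α β e b) → ℂ}
  {Q : ConstraintSystem hbar (actionOld (b := b) S) (postConstraint hbar S c)}
  {Q₁ : ConstraintSystem hbar (fun _ : CfgNew e b => (0 : ℝ)) fun j => newConstraint hbar (c j)}

/-- Independence of the representative: by `update_avg` both sides are computed from the wave
function of the physical state alone. The gauge-fixing value 0 is an arbitrary choice. -/
lemma MoveDomain.smul_proj_congr (hS : ContDiff ℝ ∞ S) (hc : ∀ j, SeriesOn hbar S Q.Φ (c j))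
    (hQ : MoveDomain Q Q₁) (M : ℂ) {f g : Q.Φ} (h : Q.proj f = Q.proj g) :
    M • Q₁.proj (hQ.integrate f) = M • Q₁.proj (hQ.integrate g) := by
  refine Q₁.wave_injective ?_
  rw [map_smul, map_smul, Q₁.wave_proj, Q₁.wave_proj, ← hQ.update_avg hS hc M 0,
    ← hQ.update_avg hS hc M 0, ← Q.wave_proj, ← Q.wave_proj, h]

/-- The state updating map `ℙ f ↦ M ℙ ∫ dx^o e^{i S / ħ} f` between physical states. -/
def MoveDomain.updateMap (hS : ContDiff ℝ ∞ S) (hc : ∀ j, SeriesOn hbar S Q.Φ (c j))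
    (hQ : MoveDomain Q Q₁) (M : ℂ) : Q.PhysState →ₗ[ℂ] Q₁.PhysState where
  toFun ψ := M • Q₁.proj (hQ.integrate (Q.rep ψ))
  map_add' ψ φ := by
    rw [hQ.smul_proj_congr hS hc M (g := Q.rep ψ + Q.rep φ), map_add, map_add, smul_add]
    rw [map_add, Q.proj_rep, Q.proj_rep, Q.proj_rep]
  map_smul' a ψ := by
    rw [hQ.smul_proj_congr hS hc M (g := a • Q.rep ψ), map_smul, map_smul, smul_comm,
      RingHom.id_apply]
    rw [map_smul, Q.proj_rep, Q.proj_rep]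

lemma MoveDomain.updateMap_proj (hS : ContDiff ℝ ∞ S) (hc : ∀ j, SeriesOn hbar S Q.Φ (c j))
    (hQ : MoveDomain Q Q₁) (M : ℂ) (f : Q.Φ) :
    hQ.updateMap hS hc M (Q.proj f) = M • Q₁.proj (hQ.integrate f) :=
  hQ.smul_proj_congr hS hc M (Q.proj_rep _)

lemma MoveDomain.wave_updateMap (hS : ContDiff ℝ ∞ S) (hc : ∀ j, SeriesOn hbar S Q.Φ (c j))
    (hQ : MoveDomain Q Q₁) (M : ℂ) (x' : α → ℝ) (ψ : Q.PhysState) :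
    Q₁.wave (hQ.updateMap hS hc M ψ) = update hbar S M x' (Q.wave ψ) := by
  rw [← Q.proj_rep ψ, hQ.updateMap_proj, map_smul, Q₁.wave_proj, Q.wave_proj,
    hQ.update_avg hS hc]

/-- State updating in matrix elements with test states. -/
lemma MoveDomain.l2_wave_updateMap (hS : ContDiff ℝ ∞ S) (hc : ∀ j, SeriesOn hbar S Q.Φ (c j))
    (hQ : MoveDomain Q Q₁) (M : ℂ) (f : Q.Φ) (φ : Q.PhysState) :
    l2 (hQ.integrate f : CfgNew e b → ℂ) (Q₁.wave (hQ.updateMap hS hc M φ)) =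
      M * (((2 * Real.pi * hbar : ℝ) : ℂ) ^ (Fintype.card α + Fintype.card β) *
        l2 (f : CfgOld α β e b → ℂ) (projB hbar S (Q.wave φ))) := by
  rw [← Q₁.inner_proj, ← Q.proj_rep φ, hQ.updateMap_proj, inner_smul_right, Q₁.inner_proj,
    Q₁.wave_proj, hQ.l2_projB hS hc, Q.wave_proj]

lemma MoveDomain.inner_updateMap (hS : ContDiff ℝ ∞ S) (hc : ∀ j, SeriesOn hbar S Q.Φ (c j))
    (hQ : MoveDomain Q Q₁) (M : ℂ) (f : Q.Φ) (φ : Q.PhysState) :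
    inner ℂ (hQ.updateMap hS hc M (Q.proj f)) (hQ.updateMap hS hc M φ) =
      ((‖M‖ ^ 2 * (2 * Real.pi * hbar) ^ (Fintype.card α + Fintype.card β) : ℝ) : ℂ) *
        l2 (f : CfgOld α β e b → ℂ) (projB hbar S (Q.wave φ)) := by
  rw [hQ.updateMap_proj, inner_smul_left, Q₁.inner_proj, hQ.l2_wave_updateMap, ← mul_assoc,
    ← Complex.normSq_eq_conj_mul_self, Complex.normSq_eq_norm_sq, ← mul_assoc]
  push_cast
  rfl

/-- The squared norm of the image is a multiple of an average of pairings of `ψ` with flowed test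
states. These are again test states, so each pairing vanishes by `l2_wave_eq_zero`. -/
lemma MoveDomain.norm_updateMap_eq_zero (hS : ContDiff ℝ ∞ S)
    (hc : ∀ j, SeriesOn hbar S Q.Φ (c j)) (hQ : MoveDomain Q Q₁) (M : ℂ) {ψ : Q.PhysState}
    (h : ‖ψ‖ = 0) : ‖hQ.updateMap hS hc M ψ‖ = 0 := by
  have h0 : inner ℂ (hQ.updateMap hS hc M ψ) (hQ.updateMap hS hc M ψ) = 0 := by
    conv_lhs => arg 2; rw [← Q.proj_rep ψ]
    rw [hQ.inner_updateMap, hQ.l2_projB_wave]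
    have : ∀ t : β → ℝ, l2 (preFlow hbar S (0, -t) (Q.rep ψ)) (Q.wave ψ) = 0 := fun t =>
      Q.l2_wave_eq_zero h ⟨_, hQ.flow_mem (0, -t) _ (Q.rep ψ).2⟩
    simp [this]
  rw [inner_self_eq_norm_sq_to_K] at h0
  simpa using h0

/-- Each test state at `k+1` is some `I f`, and the new constraint maps it to `I` of the old
constraint on `f`. The pairing becomes an average over flowed copies of that state; the flow
commutes with the constraint, so every term vanishes by hypothesis. -/
lemma MoveDomain.annihilates_updateMap (hS : ContDiff ℝ ∞ S)
    (hc : ∀ j, SeriesOn hbar S Q.Φ (c j)) (hQ : MoveDomain Q Q₁) (M : ℂ)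
    {d : List (Letter α β e b) → ℂ} (hd : SeriesOn hbar S Q.Φ d) {ψ : Q.PhysState}
    (h : Annihilates Q.Φ (oldConstraint hbar S d) (Q.wave ψ)) :
    Annihilates Q₁.Φ (newConstraint hbar d) (Q₁.wave (hQ.updateMap hS hc M ψ)) := by
  intro k hk
  obtain ⟨f, hf⟩ := hQ.integrate_surjective ⟨k, hk⟩
  set g : Q.Φ := ⟨oldConstraint hbar S d f, (hd f f.2).1⟩ with hg
  have hnew : newConstraint hbar d k = (hQ.integrate g : CfgNew e b → ℂ) := by
    have hk' : k = integrateOld hbar S f := (congrArg Subtype.val hf).symm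
    rw [hk', newConstraint_integrateOld Q.hbar_pos.ne' hS (Q.lift_apply f) (hd f f.2).2]
    rfl
  rw [hnew]
  refine ⟨Q₁.integrable_wave _ _, ?_⟩
  rw [hQ.l2_wave_updateMap, hQ.l2_projB_wave]
  have h0 : ∀ t : β → ℝ, l2 (preFlow hbar S (0, -t) g) (Q.wave ψ) = 0 := by
    intro t
    have := (h _ (hQ.flow_mem (0, -t) f f.2)).2
    rwa [oldConstraint_preFlow Q.hbar_pos.ne' hS d (Q.lift_apply f)] at this
  simp [h0]

/-- The functions `ℙ^B ψ` solve all pre-constraints. -/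
lemma MoveDomain.l2_preConstraint_projB (hS : ContDiff ℝ ∞ S)
    (hc : ∀ j, SeriesOn hbar S Q.Φ (c j)) (hQ : MoveDomain Q Q₁) (o : α ⊕ β) (f : Q.Φ)
    (ψ : Q.PhysState) :
    l2 (preConstraint hbar S o f) (projB hbar S (Q.wave ψ)) = 0 := by
  -- With `M = 1` this expresses the wanted pairing through `I (Ĉ_o f)`, which is zero.
  have h := hQ.l2_wave_updateMap hS hc 1 ⟨_, hQ.pre_mem o f f.2⟩ ψ
  have h0 : hQ.integrate ⟨_, hQ.pre_mem o f f.2⟩ = 0 :=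
    Subtype.ext (integrateOld_shiftedMomentum_old Q.hbar_pos.ne' hS (Q.lift_apply f) o)
  rw [h0, one_mul] at h
  have hne := pow_ne_zero (Fintype.card α + Fintype.card β) (planck_ne_zero Q.hbar_pos)
  refine (mul_eq_zero.1 (h.symm.trans ?_)).resolve_left hne
  simp [l2]

end TypeII

/-! ### Extension to the completions, and the theorem. -/

lemma isUnitary_of_surjective {hbar : ℝ} {Z W κ ι : Type}
    [NormedAddCommGroup Z] [NormedSpace ℝ Z] [FiniteDimensional ℝ Z] [MeasureSpace Z] [BorelSpace Z]
    [(volume : Measure Z).IsAddHaarMeasure]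
    [NormedAddCommGroup W] [NormedSpace ℝ W] [FiniteDimensional ℝ W] [MeasureSpace W] [BorelSpace W]
    [(volume : Measure W).IsAddHaarMeasure]
    [Fintype κ] [DecidableEq κ] [Fintype ι] [DecidableEq ι]
    {S : Z → ℝ} {T : W → ℝ} {C : κ → (Z → ℂ) → (Z → ℂ)} {D : ι → (W → ℂ) → (W → ℂ)}
    {Q : ConstraintSystem hbar S C} {Q₁ : ConstraintSystem hbar T D}
    (u : Q.PhysState →ₗ[ℂ] Q₁.PhysState) (hu : Function.Surjective u)
    (h : ∀ ψ, ‖u ψ‖ = ‖ψ‖) : IsUnitary u := by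
  set e₁ : Q.PhysState →ₗ[ℂ] Q.PhysSpace :=
    (UniformSpace.Completion.toComplₗᵢ (𝕜 := ℂ) (E := Q.PhysState)).toLinearMap
  set e₂ : Q₁.PhysState →ₗ[ℂ] Q₁.PhysSpace :=
    (UniformSpace.Completion.toComplₗᵢ (𝕜 := ℂ) (E := Q₁.PhysState)).toLinearMap
  have hd₁ : DenseRange e₁ := UniformSpace.Completion.denseRange_coe
  have hd₂ : DenseRange e₂ := UniformSpace.Completion.denseRange_coe
  have hn : ∀ ψ, ‖e₂ (u ψ)‖ = 1 * ‖e₁ ψ‖ := fun ψ => by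
    rw [one_mul]
    exact (UniformSpace.Completion.norm_coe _).trans
      ((h ψ).trans (UniformSpace.Completion.norm_coe _).symm)
  set v : Q.PhysSpace →L[ℂ] Q₁.PhysSpace := (e₂ ∘ₗ u).extendOfNorm e₁
  have hv : ∀ ψ : Q.PhysState, v (ψ : Q.PhysSpace) = (u ψ : Q₁.PhysSpace) := fun ψ =>
    LinearMap.extendOfNorm_eq (f := e₂ ∘ₗ u) hd₁ ⟨1, fun ψ => (hn ψ).le⟩ ψ
  have hiso : ∀ x, ‖v x‖ = ‖x‖ := fun x =>
    UniformSpace.Completion.induction_on x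
      (isClosed_eq (continuous_norm.comp v.continuous) continuous_norm) fun ψ => by
        rw [hv, UniformSpace.Completion.norm_coe, UniformSpace.Completion.norm_coe, h]
  set w : Q.PhysSpace →ₗᵢ[ℂ] Q₁.PhysSpace := ⟨v.toLinearMap, hiso⟩
  have hw : Function.Surjective w := by
    -- The range of an isometry on a complete space is closed, and it contains the dense set of
    -- physical states at `k+1`.
    have hclosed : IsClosed (Set.range w) := w.isometry.isClosedEmbedding.isClosed_range
    have hdense : DenseRange w := hd₂.mono (by
      rintro _ ⟨φ, rfl⟩
      obtain ⟨ψ, rfl⟩ := hu φ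
      exact ⟨ψ, hv ψ⟩)
    rw [← Set.range_eq_univ, ← hclosed.closure_eq, hdense.closure_range]
  exact ⟨LinearIsometryEquiv.ofSurjective w hw, hv⟩

lemma IsUnitary.inner_eq {hbar : ℝ} {Z W κ ι : Type}
    [NormedAddCommGroup Z] [NormedSpace ℝ Z] [FiniteDimensional ℝ Z] [MeasureSpace Z] [BorelSpace Z]
    [(volume : Measure Z).IsAddHaarMeasure]
    [NormedAddCommGroup W] [NormedSpace ℝ W] [FiniteDimensional ℝ W] [MeasureSpace W] [BorelSpace W]
    [(volume : Measure W).IsAddHaarMeasure]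
    [Fintype κ] [DecidableEq κ] [Fintype ι] [DecidableEq ι]
    {S : Z → ℝ} {T : W → ℝ} {C : κ → (Z → ℂ) → (Z → ℂ)} {D : ι → (W → ℂ) → (W → ℂ)}
    {Q : ConstraintSystem hbar S C} {Q₁ : ConstraintSystem hbar T D}
    {u : Q.PhysState →ₗ[ℂ] Q₁.PhysState} (h : IsUnitary u) (ψ φ : Q.PhysState) :
    inner ℂ (u ψ) (u φ) = inner ℂ ψ φ := by
  obtain ⟨v, hv⟩ := h
  rw [← UniformSpace.Completion.inner_coe (𝕜 := ℂ), ← hv, ← hv, v.inner_map_map,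
    UniformSpace.Completion.inner_coe]

end QMove

end

theorem theorem2 {α β e b ι : Type} [Fintype α] [DecidableEq α] [Fintype β] [DecidableEq β]
    [Fintype e] [DecidableEq e] [Fintype b] [DecidableEq b] [Fintype ι] [DecidableEq ι]
    (hbar : ℝ) (hhbar : 0 < hbar)
    (S : (α → ℝ) × (β → ℝ) × (e → ℝ) → ℝ) (hS : ContDiff ℝ ∞ S)
    (c : ι → List (Letter α β e b) → ℂ)
    (Q : ConstraintSystem hbar (actionOld (b := b) S) (postConstraint hbar S c))
    (Q₁ : ConstraintSystem hbar (fun _ : CfgNew e b => (0 : ℝ)) fun j => newConstraint hbar (c j))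
    (hc : ∀ j, SeriesOn hbar S Q.Φ (c j))
    (hQ : MoveDomain Q Q₁)
    (hβ : ∀ i : β, IsNontrivialFirstClass Q i)
    (M : ℂ) (x' : α → ℝ) :
    ∃ u : Q.PhysState →ₗ[ℂ] Q₁.PhysState,
      (∀ ψ, Q₁.wave (u ψ) = update hbar S M x' (Q.wave ψ)) ∧
      (∀ ψ, ‖ψ‖ = 0 → ‖u ψ‖ = 0) ∧
      (∀ j ψ, Annihilates Q₁.Φ (newConstraint hbar (c j)) (Q₁.wave (u ψ))) ∧
      (∀ d : List (Letter α β e b) → ℂ, SeriesOn hbar S Q.Φ d →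
        ∀ ψ, Annihilates Q.Φ (oldConstraint hbar S d) (Q.wave ψ) →
          Annihilates Q₁.Φ (newConstraint hbar d) (Q₁.wave (u ψ))) ∧
      (∀ (f : Q.Φ) (φ : Q.PhysState),
        inner ℂ (u (Q.proj f)) (u φ) =
          ((‖M‖ ^ 2 * (2 * Real.pi * hbar) ^ (Fintype.card α + Fintype.card β) : ℝ) : ℂ) *
            l2 (f : CfgOld α β e b → ℂ) (projB hbar S (Q.wave φ))) ∧
      (IsEmpty β → ‖M‖ ^ 2 * (2 * Real.pi * hbar) ^ (Fintype.card α + Fintype.card β) = 1 →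
        IsUnitary u) ∧
      (Nonempty β → ¬ IsUnitary u ∧ ∃ ψ φ : Q.PhysState, inner ℂ (u ψ) (u φ) ≠ inner ℂ ψ φ) := by
  refine ⟨hQ.updateMap hS hc M, hQ.wave_updateMap hS hc M x',
    fun ψ hψ => hQ.norm_updateMap_eq_zero hS hc M hψ,
    -- The image is itself a group average at `k+1`, so it solves the post-constraints there.
    fun j ψ => Q₁.annihilates_wave j _,
    fun d hd ψ hψ => hQ.annihilates_updateMap hS hc M hd hψ,
    hQ.inner_updateMap hS hc M, fun hβ0 hM => ?_, fun ⟨i⟩ => ?_⟩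
  · have hinner : ∀ ψ, inner ℂ (hQ.updateMap hS hc M ψ) (hQ.updateMap hS hc M ψ) =
        inner ℂ ψ ψ := by
      intro ψ
      obtain ⟨f, rfl⟩ : ∃ f, Q.proj f = ψ := ⟨_, Q.proj_rep ψ⟩
      rw [hQ.inner_updateMap, hM, Complex.ofReal_one, one_mul, projB_of_isEmpty, Q.inner_proj]
    have hM0 : M ≠ 0 := by
      rintro rfl
      simp at hM
    refine isUnitary_of_surjective _ (fun φ => ?_) fun ψ => ?_
    -- The factor `M⁻¹` compensates the `M` in `𝔲 ℙ f = M ℙ I f`.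
    · obtain ⟨f, hf⟩ := hQ.integrate_surjective (Q₁.rep (M⁻¹ • φ))
      refine ⟨Q.proj f, ?_⟩
      rw [hQ.updateMap_proj, hf, Q₁.proj_rep, smul_inv_smul₀ hM0]
    · rw [@norm_eq_sqrt_re_inner ℂ, hinner, ← @norm_eq_sqrt_re_inner ℂ]
  · obtain ⟨⟨ψ, hψ⟩, -⟩ := hβ i
    have key : ∃ χ φ : Q.PhysState,
        inner ℂ (hQ.updateMap hS hc M χ) (hQ.updateMap hS hc M φ) ≠ inner ℂ χ φ := by
      by_contra! h
      refine hψ fun f hf => ?_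
      have hmem := hQ.pre_mem (Sum.inr i) f hf
      refine ⟨Q.integrable_wave ⟨_, hmem⟩ ψ, ?_⟩
      -- Testing preservation on `ℙ (Ĉ_β f)` and `ψ`: the image side is a multiple of `⟨Ĉ_β f | ℙ^B
      -- ψ⟩ = 0`, the original side is `⟨Ĉ_β f | ψ⟩`.
      have h1 := h (Q.proj ⟨_, hmem⟩) ψ
      rw [hQ.inner_updateMap, Q.inner_proj] at h1
      rw [← h1]
      exact mul_eq_zero_of_right _ (hQ.l2_preConstraint_projB hS hc (Sum.inr i) ⟨f, hf⟩ ψ)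
    obtain ⟨χ, φ, hne⟩ := key
    exact ⟨fun hu => hne (hu.inner_eq χ φ), χ, φ, hne⟩
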